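/- **Setting.** Let $b,n$ be positive integers. $b^{<n}$ is the set of all sequences in $\{0,\dots,b-1\}$ of length less than $n$; $|s|$ is the length of $s$, $\sqsubseteq$ is the initial segment ordering ($\sqsubset$ its strict part), and $s\le_{\mathrm{lex}}t$ means that $s\sqsubseteq t$, or that $s,t$ are $\sqsubseteq$-incomparable and $s(i)<t(i)$ at the first place $i$ where they differ. For $S\subseteq b^{<n}$ and $s\in S$ let $h_S(s)=|\{t\in S: t\sqsubset s\}|$, and let $\mathrm{ImSucc}_S(s)$ be the set of all $t\in S$ with $s\sqsubset t$ such that no $t'\in S$ satisfies $s\sqsubset t'\sqsubset t$. For a positive integer $k$, a *$k$-complete skew subtree* of $b^{<n}$ is a set $S\subseteq b^{<n}$ such that (i) $S$ has a $\sqsubseteq$-minimum and every $\sqsubseteq$-maximal chain of $S$ has exactly $k$ elements; (ii) if $s,s'\in S$, $h_S(s)=h_S(s')$ and $s\le_{\mathrm{lex}}s'$, then $|s|\le|s'|$; (iii) if $s,s'\in S$ and $h_S(s)<h_S(s')$, then $|s|<|s'|$; (iv) for every $s\in S$ that is not $\sqsubseteq$-maximal in $S$ and every $i\in\{0,\dots,b-1\}$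 there is a unique $t\in\mathrm{ImSucc}_S(s)$ with $s^\frown(i)\sqsubseteq t$. Let $\Lambda$ be a finite alphabet, and let $v_t$ $(t\in b^{<n})$ be distinct symbols not in $\Lambda$. For a $k$-complete skew subtree $T$, a *$T$-variable word* is a map $f:b^{<n}\to\Lambda\cup\{v_t:t\in T\}$ such that for every $t\in T$ the set $f^{-1}(v_t)$ is nonempty and has $t$ as its $\sqsubseteq$-minimum. $W_{v,k}(b,n,\Lambda)$ is the set of all $T$-variable words, over all $k$-complete skew subtrees $T$ of $b^{<n}$. The *span* $[f]_\Lambda$ of a $T$-variable word $f$ is the set of all maps $b^{<n}\to\Lambda$ obtained from $f$ by replacing, for every $t\in T$, all occurrences of $v_t$ by a letter $\alpha_t\in\Lambda$, over all choices $(\alpha_t)_{t\in T}\in\Lambda^T$. For a variable word $f$ put $W_{v,k}(f)=\{g\in W_{v,k}(b,n,\Lambda):[g]_\Lambda\subseteq[f]_\Lambda\}$. **Theorem.** For all positive integers $b,\ell,k,m,r$ with $\ell\ge 2$ there is a positive integer $n_0$ with the following property. For every integer $n\ge n_0$, every alphabet $\Lambda$ with exactly $\ell$ elements and every coloring of $W_{v,k}(b,n,\Lambda)$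 with $r$ colors, there is $f\in W_{v,m}(b,n,\Lambda)$ such that the set $W_{v,k}(f)$ is monochromatic. -/

import Mathlib

namespace TreeWords

/-- The tree `b^{<n}`: all sequences in `{0, …, b-1}` of length less than `n`. -/
abbrev Node (b n : ℕ) : Type := {s : List (Fin b) // s.length < n}

namespace Node

variable {b n : ℕ}

/-- The length `|s|` of `s`. -/
def len (s : Node b n) : ℕ := s.1.length

/-- The initial segment ordering `s ⊑ t`. -/
def Init (s t : Node b n) : Prop := s.1 <+: t.1

/-- The strict initial segment ordering `s ⊏ t`. -/
def SInit (s t : Node b n) : Prop := Init s t ∧ s ≠ t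

/-- The (reflexive) lexicographical order: `s` is an initial segment of `t`, or `s` and `t` are
incomparable and, at the first place `|s ∧ t|` where they differ, the entry of `s` is the
smaller one (`u` is the meet `s ∧ t`). -/
def LexLE (s t : Node b n) : Prop :=
  Init s t ∨ ∃ (u : List (Fin b)) (i j : Fin b), i < j ∧ (u ++ [i]) <+: s.1 ∧ (u ++ [j]) <+: t.1

end Node

section Subtrees

variable {b n : ℕ}

/-- `Pred_S(s)`: the strict predecessors of `s` inside `S`. -/
def predSet (S : Set (Node b n)) (s : Node b n) : Set (Node b n) := {t ∈ S | Node.SInit t s}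

/-- `ImSucc_S(s)`: the immediate successors of `s` inside `S`. -/
def imSucc (S : Set (Node b n)) (s : Node b n) : Set (Node b n) :=
  {t ∈ S | Node.SInit s t ∧ ¬ ∃ t' ∈ S, Node.SInit s t' ∧ Node.SInit t' t}

/-- `h_S(s)`: the height of `s` in `S`, the number of its predecessors inside `S`. -/
noncomputable def height (S : Set (Node b n)) (s : Node b n) : ℕ := (predSet S s).ncard

/-- `C` is a maximal chain of the subtree `S`, with respect to `⊑`. -/
def IsMaxChainIn (S C : Set (Node b n)) : Prop :=
  C ⊆ S ∧ IsChain Node.Init C ∧ ∀ D ⊆ S, IsChain Node.Init D → C ⊆ D → D = C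

/-- `S` is a `k`-complete skew subtree of `b^{<n}`. -/
structure IsCompleteSkew (k : ℕ) (S : Set (Node b n)) : Prop where
  exists_min : ∃ r ∈ S, ∀ s ∈ S, Node.Init r s
  maxChain_card : ∀ C, IsMaxChainIn S C → C.ncard = k
  len_le_of_lex : ∀ s ∈ S, ∀ s' ∈ S, height S s = height S s' → Node.LexLE s s' → s.len ≤ s'.len
  len_lt_of_height : ∀ s ∈ S, ∀ s' ∈ S, height S s < height S s' → s.len < s'.len
  existsUnique_succ : ∀ s ∈ S, (∃ t ∈ S, Node.SInit s t) → ∀ i : Fin b,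
    ∃! t, t ∈ imSucc S s ∧ (s.1 ++ [i]) <+: t.1

end Subtrees

section Words

universe u

variable {b n : ℕ} {Λ : Type u}

/-- `f` is a `T`-variable word. A value `Sum.inl a` is the letter `a` of the alphabet, and
`Sum.inr t` is the variable symbol `v_t`: only the symbols `v_t` with `t ∈ T` occur, and for
`t ∈ T` the set `f⁻¹(v_t)` contains `t` and has `t` as its `⊑`-minimum. -/
def IsVariableWord (T : Set (Node b n)) (f : Node b n → Λ ⊕ Node b n) : Prop :=
  (∀ x t, f x = Sum.inr t → t ∈ T) ∧
    ∀ t ∈ T, f t = Sum.inr t ∧ ∀ x, f x = Sum.inr t → Node.Init t x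

/-- `W_{v,k}(b,n,Λ)`: the `T`-variable words, over all `k`-complete skew subtrees `T`. -/
def variableWords (b n k : ℕ) (Λ : Type u) : Set (Node b n → Λ ⊕ Node b n) :=
  {f | ∃ T : Set (Node b n), IsCompleteSkew k T ∧ IsVariableWord T f}

/-- The word obtained from `f` by substituting each occurrence of `v_t` by `α t`. Only the
values of `α` at the `t` for which `v_t` occurs in `f` matter. -/
def substitute (f : Node b n → Λ ⊕ Node b n) (α : Node b n → Λ) : Node b n → Λ :=
  fun x => Sum.elim id α (f x)

/-- The span `[f]_Λ`. -/
def span (f : Node b n → Λ ⊕ Node b n) : Set (Node b n → Λ) :=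
  {w | ∃ α : Node b n → Λ, w = substitute f α}

/-- `W_{v,k}(f)`: the `k`-dimensional variable words whose span lies in the span of `f`. -/
def subWords (k : ℕ) (f : Node b n → Λ ⊕ Node b n) : Set (Node b n → Λ ⊕ Node b n) :=
  {g ∈ variableWords b n k Λ | span g ⊆ span f}

end Words

end TreeWords

/-! Words are extended to the infinite tree, where they compose: in `comp f h` the variables of `f`
are replaced by the values of `h`, and `IsEmb` records the first occurrences, which form a copy of a
finite tree. As the alphabet has two letters, an inclusion of spans makes a subword of `f` factor as
`comp f h`. If the first occurrences of `f` have lengths increasing strictly in breadth-first order,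
the skew conditions on the subword say that the first occurrences `χ s` of `h` keep that order
(`IsEmb.exists_restrict_comp_eq`). It remains to find `f` such that the color of `comp f h` does not
depend on `h`; this takes three rounds.

Round 1 (`exists_deadInsensitive`) removes the values at dead positions, those that are not initial
segments of any `χ s`. Level after level is stretched to a block, with a Hales–Jewett line along `t,
t⌢(0), t⌢(0,0), …` above each node `t` of the level. A dead `t` turns its line into a word, a live
`t` keeps a line; `exists_lines` makes the color independent of the letters at dead nodes, for all
patterns of live nodes simultaneously.

Round 2 (`exists_levelInsensitive`) removes the shape of the paths to the `χ s` and the values on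
them. On a level without first occurrences each live node has one direction and one letter
(`direction_unique`), so the whole level is a single letter of a finite alphabet, and one
Hales–Jewett line removes it. On a level with a first occurrence the condition `Neat` prescribes the
direction `0` and the value `a₀` on all other paths, so nothing needs to be removed. What survives
is the lengths of the `χ s`.

Round 3 (`exists_monochromatic_word`) applies Ramsey's theorem to the sets of these lengths. A
sparse copy of the tree, with lengths in a homogeneous set and padded by `0` and `a₀`, has only neat
subwords. -/

namespace TreeWords

/-! ### Initial segments of finite sequences -/

section Prefixes

variable {α : Type*}

theorem prefix_trichotomy (s t : List α) :
    s <+: t ∨ (∃ i, t ++ [i] <+: s) ∨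
      ∃ v i j, i ≠ j ∧ v ++ [i] <+: s ∧ v ++ [j] <+: t := by
  induction s generalizing t with
  | nil => exact Or.inl t.nil_prefix
  | cons a s ih =>
    cases t with
    | nil => exact Or.inr (Or.inl ⟨a, by simp⟩)
    | cons c t =>
      by_cases hac : a = c
      · subst hac
        rcases ih t with h | ⟨i, h⟩ | ⟨v, i, j, hij, h, h'⟩
        · exact Or.inl (by simpa using h)
        · exact Or.inr (Or.inl ⟨i, by simpa using h⟩)
        · exact Or.inr (Or.inr ⟨a :: v, i, j, hij, by simpa using h, by simpa using h'⟩)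
      · exact Or.inr (Or.inr ⟨[], a, c, hac, by simp, by simp⟩)

theorem exists_append_singleton_prefix {s t : List α} (h : s <+: t) (hne : s ≠ t) :
    ∃ i, s ++ [i] <+: t := by
  obtain ⟨_ | ⟨i, r⟩, rfl⟩ := h
  · simp at hne
  · exact ⟨i, r, by simp⟩

theorem exists_append_singleton_prefix_of_length_lt {s t : List α} (h : s <+: t)
    (hlt : s.length < t.length) : ∃ i, s ++ [i] <+: t :=
  exists_append_singleton_prefix h (by rintro rfl; simp at hlt)

theorem prefix_of_append_singleton_prefix {s t : List α} {i : α} (h : s ++ [i] <+: t) : s <+: t :=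
  (List.prefix_append s [i]).trans h

theorem length_lt_of_append_singleton_prefix {s t : List α} {i : α} (h : s ++ [i] <+: t) :
    s.length < t.length := by
  simpa [Nat.succ_le_iff] using h.length_le

theorem eq_of_append_singleton_prefix {s t : List α} {i j : α} (h : s ++ [i] <+: t)
    (h' : s ++ [j] <+: t) : i = j := by
  have := List.prefix_of_prefix_length_le h h' (by simp)
  simpa using this

theorem prefix_antisymm {s t : List α} (h : s <+: t) (h' : t <+: s) : s = t :=
  h.eq_of_length (le_antisymm h.length_le h'.length_le)

theorem take_eq_of_prefix {s t : List α} (h : s <+: t) : t.take s.length = s :=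
  (List.prefix_iff_eq_take.1 h).symm

end Prefixes

/-! ### Embeddings of trees -/

variable {b : ℕ}

/-- `φ` maps the sequences of length less than `m` to sequences, and preserves the relation
`t⌢(i) ⊑ t'`. -/
def IsTreeMap (m : ℕ) (φ : List (Fin b) → List (Fin b)) : Prop :=
  ∀ t i, t.length + 1 < m → φ t ++ [i] <+: φ (t ++ [i])

namespace IsTreeMap

variable {m : ℕ} {φ : List (Fin b) → List (Fin b)}

theorem prefix_mono (h : IsTreeMap m φ) {s t : List (Fin b)} (ht : t.length < m) (hst : s <+: t) :
    φ s <+: φ t := by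
  obtain ⟨r, rfl⟩ := hst
  induction r using List.reverseRecOn with
  | nil => simp
  | append_singleton r i ih =>
    rw [← List.append_assoc] at ht ⊢
    have hl : (s ++ r).length + 1 < m := by simpa [add_assoc] using ht
    exact (ih (by omega)).trans (prefix_of_append_singleton_prefix (h _ i hl))

theorem append_prefix (h : IsTreeMap m φ) {s t : List (Fin b)} {i : Fin b} (ht : t.length < m)
    (hst : s ++ [i] <+: t) : φ s ++ [i] <+: φ t :=
  (h s i (by have := hst.length_le; simp at this; omega)).trans (h.prefix_mono ht hst)

/-- Two branches that split in different directions have images that split in the same directions,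
and a proper extension has a longer image; neither is compatible with `φ s <+: φ t`. -/
theorem prefix_reflect (h : IsTreeMap m φ) {s t : List (Fin b)} (hs : s.length < m)
    (ht : t.length < m) (hst : φ s <+: φ t) : s <+: t := by
  rcases prefix_trichotomy s t with h1 | ⟨i, h1⟩ | ⟨v, i, j, hij, h1, h2⟩
  · exact h1
  · have := length_lt_of_append_singleton_prefix (h.append_prefix hs h1)
    have := hst.length_le
    omega
  · exact absurd (eq_of_append_singleton_prefix ((h.append_prefix hs h1).trans hst)
      (h.append_prefix ht h2)) hij

theorem injOn (h : IsTreeMap m φ) {s t : List (Fin b)} (hs : s.length < m)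
    (ht : t.length < m) (hst : φ s = φ t) : s = t :=
  prefix_antisymm (h.prefix_reflect hs ht (by rw [hst])) (h.prefix_reflect ht hs (by rw [hst]))

theorem append_prefix_reflect (h : IsTreeMap m φ) {s t : List (Fin b)} {i : Fin b}
    (hs : s.length < m) (ht : t.length < m) (hst : φ s ++ [i] <+: φ t) : s ++ [i] <+: t := by
  have h1 := h.prefix_reflect hs ht (prefix_of_append_singleton_prefix hst)
  obtain ⟨j, hj⟩ := exists_append_singleton_prefix h1 (by
    rintro rfl
    have := length_lt_of_append_singleton_prefix hst
    omega)
  rwa [eq_of_append_singleton_prefix hst (h.append_prefix ht hj)]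

theorem comp {k : ℕ} {χ : List (Fin b) → List (Fin b)} (h : IsTreeMap m φ) (hχ : IsTreeMap k χ)
    (hlt : ∀ s, s.length < k → (χ s).length < m) : IsTreeMap k (φ ∘ χ) :=
  fun t i ht => h.append_prefix (hlt _ (by simpa using ht)) (hχ t i ht)

end IsTreeMap

/-- A map from sequences to letters and variables; the variables are indexed by sequences. -/
abbrev Word (b : ℕ) (Λ : Type*) : Type _ := List (Fin b) → Λ ⊕ List (Fin b)

variable {Λ : Type*}

/-- Replace every variable `v_t` of `f` by the value of `h` at `t`. -/
def comp (f h : Word b Λ) : Word b Λ := fun z => Sum.elim Sum.inl h (f z)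

theorem comp_of_inl {f h : Word b Λ} {z : List (Fin b)} {a : Λ} (hz : f z = Sum.inl a) :
    comp f h z = Sum.inl a := by simp [comp, hz]

theorem comp_of_inr {f h : Word b Λ} {z t : List (Fin b)} (hz : f z = Sum.inr t) :
    comp f h z = h t := by simp [comp, hz]

theorem comp_assoc (f g h : Word b Λ) : comp (comp f g) h = comp f (comp g h) := by
  funext z
  unfold comp
  cases f z <;> rfl

/-- The word `f` carries exactly the variables `v_t` with `|t| < m`, the first occurrence of `v_t`
is at `φ t`, the positions `φ t` form a copy of the tree of height `m`, and `f` has the fixed value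
`a₀` at all sequences of length at least `n`. -/
structure IsEmb (a₀ : Λ) (m n : ℕ) (f : Word b Λ) (φ : List (Fin b) → List (Fin b)) : Prop where
  apply_pos : ∀ t, t.length < m → f (φ t) = Sum.inr t
  of_inr : ∀ z t, f z = Sum.inr t → t.length < m ∧ φ t <+: z
  treeMap : IsTreeMap m φ
  const : ∀ z, n ≤ z.length → f z = Sum.inl a₀

namespace IsEmb

variable {a₀ : Λ} {k m n : ℕ} {f h : Word b Λ} {φ χ : List (Fin b) → List (Fin b)}

theorem length_lt (hf : IsEmb a₀ m n f φ) {t : List (Fin b)} (ht : t.length < m) :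
    (φ t).length < n := by
  by_contra hlt
  simpa [hf.apply_pos t ht] using hf.const (φ t) (by omega)

theorem comp (hf : IsEmb a₀ m n f φ) (hh : IsEmb a₀ k m h χ) :
    IsEmb a₀ k n (comp f h) (φ ∘ χ) where
  apply_pos t ht := by
    rw [Function.comp, comp_of_inr (hf.apply_pos _ (hh.length_lt ht)), hh.apply_pos t ht]
  of_inr z t hz := by
    unfold TreeWords.comp at hz
    cases hfz : f z with
    | inl a => simp [hfz] at hz
    | inr u =>
      simp only [hfz, Sum.elim_inr] at hz
      obtain ⟨hu, huz⟩ := hf.of_inr z u hfz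
      obtain ⟨ht, htu⟩ := hh.of_inr u t hz
      exact ⟨ht, (hf.treeMap.prefix_mono hu htu).trans huz⟩
  treeMap := hf.treeMap.comp hh.treeMap fun _ hs => hh.length_lt hs
  const z hz := comp_of_inl (hf.const z hz)

/-- Both positions are occurrences of `v_t`, and each, being the first one, lies below the other. -/
theorem pos_unique (hf : IsEmb a₀ m n f φ) (hf' : IsEmb a₀ m n f χ) {t : List (Fin b)}
    (ht : t.length < m) : φ t = χ t :=
  prefix_antisymm (hf.of_inr _ _ (hf'.apply_pos t ht)).2 (hf'.of_inr _ _ (hf.apply_pos t ht)).2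

theorem congr_pos (hf : IsEmb a₀ m n f φ) (h : ∀ t, t.length < m → φ t = χ t) :
    IsEmb a₀ m n f χ where
  apply_pos t ht := by rw [← h t ht, hf.apply_pos t ht]
  of_inr z t hz := by
    have := hf.of_inr z t hz
    exact ⟨this.1, by rw [← h t this.1]; exact this.2⟩
  treeMap t i ht := by
    rw [← h t (by omega), ← h (t ++ [i]) (by simpa using ht)]
    exact hf.treeMap t i ht
  const := hf.const

theorem mono_right {n' : ℕ} (hf : IsEmb a₀ m n f φ) (h : n ≤ n') : IsEmb a₀ m n' f φ :=
  ⟨hf.apply_pos, hf.of_inr, hf.treeMap, fun z hz => hf.const z (h.trans hz)⟩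

/-- The word all of whose variables occur exactly once, at the positions prescribed by `φ`. -/
theorem exists_of_treeMap (a₀ : Λ) (hφ : IsTreeMap m φ)
    (hlt : ∀ t, t.length < m → (φ t).length < n) :
    ∃ f : Word b Λ, IsEmb a₀ m n f φ ∧
      ∀ z, (∀ t, t.length < m → z ≠ φ t) → f z = Sum.inl a₀ := by
  classical
  let f : Word b Λ := fun z =>
    if hz : ∃ t, t.length < m ∧ z = φ t then Sum.inr hz.choose else Sum.inl a₀
  have h1 : ∀ z, (∀ t, t.length < m → z ≠ φ t) → f z = Sum.inl a₀ := fun z hz =>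
    dif_neg (by rintro ⟨t, ht, h⟩; exact hz t ht h)
  have h2 : ∀ t, t.length < m → f (φ t) = Sum.inr t := by
    intro t ht
    have hz : ∃ t', t'.length < m ∧ φ t = φ t' := ⟨t, ht, rfl⟩
    have := hz.choose_spec
    simp only [f, dif_pos hz]
    rw [← hφ.injOn ht this.1 this.2]
  refine ⟨f, ⟨h2, fun z t hz => ?_, hφ, fun z hz => h1 z ?_⟩, h1⟩
  · by_cases hz' : ∃ t, t.length < m ∧ z = φ t
    · obtain ⟨t', ht', rfl⟩ := hz'
      rw [h2 t' ht'] at hz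
      obtain rfl := Sum.inr_injective hz
      exact ⟨ht', List.prefix_rfl⟩
    · simp [f, dif_neg hz'] at hz
  · rintro t ht rfl
    have := hlt t ht
    omega

end IsEmb

/-- `φ` is strictly monotone with respect to the lengths of the sequences. -/
def LevelMono (m : ℕ) (φ : List (Fin b) → List (Fin b)) : Prop :=
  ∀ t t', t.length < t'.length → t'.length < m → (φ t).length < (φ t').length

theorem LevelMono.comp {k m : ℕ} {φ χ : List (Fin b) → List (Fin b)} (h : LevelMono m φ)
    (hχ : LevelMono k χ) (hlt : ∀ s, s.length < k → (χ s).length < m) : LevelMono k (φ ∘ χ) :=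
  fun t t' htt' ht' => h _ _ (hχ t t' htt' ht') (hlt _ ht')

/-- `h` and `h'` agree at the positions that have an extension of the form `χ s`. -/
def AgreeBelow (k : ℕ) (χ : List (Fin b) → List (Fin b)) (h h' : Word b Λ) : Prop :=
  ∀ z s, s.length < k → z <+: χ s → h z = h' z

/-- The coloring `c` of the words with `k` levels of variables and height `n` only depends on the
first occurrences of the variables and on the values below them. -/
def DeadInsensitive {r : ℕ} (a₀ : Λ) (k n : ℕ) (c : Word b Λ → Fin r) : Prop :=
  ∀ g g' χ, IsEmb a₀ k n g χ → IsEmb a₀ k n g' χ → AgreeBelow k χ g g' → c g = c g'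

/-- Functions on this finite set serve as palettes below, so that a single use of Hales–Jewett
treats all words `h` simultaneously. -/
theorem finite_isEmb [Finite Λ] (a₀ : Λ) (k m : ℕ) :
    {h : Word b Λ | ∃ χ, IsEmb a₀ k m h χ}.Finite := by
  have hfin : ∀ l, Finite {z : List (Fin b) // z.length < l} := fun l =>
    (List.finite_length_lt (Fin b) l).to_subtype
  have := hfin k
  have := hfin m
  let G : ({z : List (Fin b) // z.length < m} → Λ ⊕ {s : List (Fin b) // s.length < k}) →
      Word b Λ := fun F z =>
    if hz : z.length < m then Sum.map id Subtype.val (F ⟨z, hz⟩) else Sum.inl a₀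
  refine (Set.finite_range G).subset ?_
  rintro h ⟨χ, hh⟩
  have : ∀ z, ∃ y : Λ ⊕ {s : List (Fin b) // s.length < k}, Sum.map id Subtype.val y = h z := by
    intro z
    cases hz : h z with
    | inl a => exact ⟨Sum.inl a, rfl⟩
    | inr s => exact ⟨Sum.inr ⟨s, (hh.of_inr z s hz).1⟩, rfl⟩
  choose y hy using this
  refine ⟨fun z => y z.1, ?_⟩
  funext z
  by_cases hz : z.length < m
  · simp [G, hz, hy]
  · simp [G, hz, hh.const z (by omega)]

/-! ### The Hales–Jewett theorem for several blocks -/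

section Blocks

variable {A : Type*}

/-- A block is either a word or a line. The configuration determined by the lines `ℓ` and the
partial assignment `x` consists of the words of `ℓ j` at `a` where `x j = some a`, and
of the lines `ℓ j` where `x j = none`. -/
def blockConfig {J : Type*} (ℓ : J → ℕ → Option A) (x : J → Option A) (j : J) :
    (ℕ → A) ⊕ (ℕ → Option A) :=
  match x j with
  | some a => Sum.inl fun i => (ℓ j i).getD a
  | none => Sum.inr (ℓ j)

theorem exists_line_mono (A κ : Type*) [Finite A] [Finite κ] [Inhabited A] :
    ∃ n, ∀ C : (ℕ → A) → κ, ∃ ℓ : ℕ → Option A, (∃ i < n, ℓ i = none) ∧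
      ∀ a a', C (fun i => (ℓ i).getD a) = C (fun i => (ℓ i).getD a') := by
  obtain ⟨ι, _, h⟩ := Combinatorics.Line.exists_mono_in_high_dimension A κ
  let e := Fintype.equivFin ι
  -- The finite index set is moved to an initial segment of `ℕ`, and all later places carry the
  -- constant letter `default`.
  refine ⟨Fintype.card ι, fun C => ?_⟩
  obtain ⟨l, c, hl⟩ := h fun w =>
    C fun i => if hi : i < Fintype.card ι then w (e.symm ⟨i, hi⟩) else default
  refine ⟨fun i => if hi : i < Fintype.card ι then l.idxFun (e.symm ⟨i, hi⟩) else some default,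
    ?_, ?_⟩
  · obtain ⟨i, hi⟩ := l.proper
    exact ⟨e i, (e i).2, by simp [hi]⟩
  · have key : ∀ a, C (fun i => (if hi : i < Fintype.card ι then l.idxFun (e.symm ⟨i, hi⟩)
        else some default).getD a) = c := by
      intro a
      rw [← hl a]
      congr 1
      funext i
      split_ifs <;> simp
    intro a a'
    rw [key a, key a']

/-- Cut off a sequence at `n`. -/
def cutoff {X : Type*} (d : X) (n : ℕ) (w : ℕ → X) (i : ℕ) : X := if i < n then w i else d

/-- Induction on the number of blocks. The line of the last block is found first, uniformly in the
other blocks; then the last block has only two essentially different states, word or line, and the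
induction hypothesis handles the pair of colors. -/
theorem exists_lines_fin (A : Type*) [Finite A] [Inhabited A] (q : ℕ) :
    ∀ (κ : Type*) [Finite κ], ∃ n, ∀ C : (Fin q → (ℕ → A) ⊕ (ℕ → Option A)) → κ,
      ∃ ℓ : Fin q → ℕ → Option A, (∀ j, ∃ i < n, ℓ j i = none) ∧
        ∀ x y : Fin q → Option A, (∀ j, x j = none ↔ y j = none) →
          C (blockConfig ℓ x) = C (blockConfig ℓ y) := by
  induction q with
  | zero =>
    intro κ _
    exact ⟨0, fun C => ⟨fun j => j.elim0, fun j => j.elim0,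
      fun x y _ => congrArg C (funext fun j => j.elim0)⟩⟩
  | succ q ih =>
    intro κ _
    obtain ⟨n₁, h₁⟩ := ih (Bool → κ)
    let Ω := (Fin n₁ → A) ⊕ (Fin n₁ → Option A)
    let ext : Ω → (ℕ → A) ⊕ (ℕ → Option A) := Sum.map
      (fun w i => if hi : i < n₁ then w ⟨i, hi⟩ else default)
      (fun w i => if hi : i < n₁ then w ⟨i, hi⟩ else some default)
    have hext : ∀ o : (ℕ → A) ⊕ (ℕ → Option A), ∃ o' : Ω, ext o' =
        Sum.map (cutoff default n₁) (cutoff (some default) n₁) o := by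
      rintro (w | w)
      · refine ⟨Sum.inl fun i => w i, ?_⟩
        simp only [ext, Sum.map_inl, Sum.inl.injEq]
        funext i
        simp [cutoff]
      · refine ⟨Sum.inr fun i => w i, ?_⟩
        simp only [ext, Sum.map_inr, Sum.inr.injEq]
        funext i
        simp [cutoff]
    -- The palette lists the colors for all configurations of the first `q` blocks; it is finite
    -- because these are cut off at `n₁`.
    obtain ⟨n₂, h₂⟩ := exists_line_mono A ((Fin q → Ω) → κ)
    refine ⟨max n₁ n₂, fun C => ?_⟩
    obtain ⟨l, ⟨i₀, hi₀, hl₀⟩, hl⟩ := h₂ fun w ω => C (Fin.snoc (fun j => ext (ω j)) (Sum.inl w))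
    -- The Boolean selects a word or the line `l` in the last block. One word suffices, since the
    -- color is constant on the words of `l`.
    obtain ⟨ℓ, hℓ₀, hℓ⟩ := h₁ fun ω t => C (Fin.snoc
      (fun j => Sum.map (cutoff default n₁) (cutoff (some default) n₁) (ω j))
      (if t then Sum.inl fun i => (l i).getD default else Sum.inr l))
    have hconf : ∀ (x : Fin (q + 1) → Option A),
        blockConfig (Fin.snoc (fun j => cutoff (some default) n₁ (ℓ j)) l) x =
          (Fin.snoc (fun j => Sum.map (cutoff default n₁) (cutoff (some default) n₁)
            (blockConfig ℓ (fun j => x j.castSucc) j)) (match x (Fin.last q) with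
              | some a => Sum.inl fun i => (l i).getD a
              | none => Sum.inr l) : Fin (q + 1) → (ℕ → A) ⊕ (ℕ → Option A)) := by
      intro x
      funext j
      induction j using Fin.lastCases with
      | last => simp [blockConfig]
      | cast j =>
        simp only [blockConfig, Fin.snoc_castSucc]
        cases x j.castSucc with
        | none => simp
        | some a =>
          simp only [Sum.map_inl, Sum.inl.injEq]
          funext i
          unfold cutoff
          split_ifs <;> simp
    refine ⟨Fin.snoc (fun j => cutoff (some default) n₁ (ℓ j)) l, ?_, ?_⟩
    · intro j
      induction j using Fin.lastCases with
      | last => exact ⟨i₀, lt_max_of_lt_right hi₀, by simpa using hl₀⟩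
      | cast j =>
        obtain ⟨i, hi, hi'⟩ := hℓ₀ j
        exact ⟨i, lt_max_of_lt_left hi, by simp [cutoff, hi, hi']⟩
    · intro x y hxy
      rw [hconf, hconf]
      have h3 := hℓ (fun j => x j.castSucc) (fun j => y j.castSucc) fun j => hxy _
      have h4 : ∀ (ω : Fin q → (ℕ → A) ⊕ (ℕ → Option A)) a a',
          C (Fin.snoc (fun j => Sum.map (cutoff default n₁) (cutoff (some default) n₁) (ω j))
            (Sum.inl fun i => (l i).getD a)) =
          C (Fin.snoc (fun j => Sum.map (cutoff default n₁) (cutoff (some default) n₁) (ω j))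
            (Sum.inl fun i => (l i).getD a')) := by
        intro ω a a'
        choose ω' hω' using fun j => hext (ω j)
        simpa only [hω'] using congrFun (hl a a') ω'
      have hlast := hxy (Fin.last q)
      cases hx : x (Fin.last q) with
      | none =>
        rw [hlast.1 hx]
        simpa using congrFun h3 false
      | some a =>
        cases hy : y (Fin.last q) with
        | none => simp [hx, hy] at hlast
        | some a' =>
          have h5 := congrFun h3 true
          simp only [if_true] at h5
          exact (h4 _ a default).trans (h5.trans (h4 _ default a'))

theorem exists_lines (A : Type*) [Finite A] [Inhabited A] (J : Type*) [Finite J]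
    (κ : Type*) [Finite κ] : ∃ n, ∀ C : (J → (ℕ → A) ⊕ (ℕ → Option A)) → κ,
      ∃ ℓ : J → ℕ → Option A, (∀ j, ∃ i < n, ℓ j i = none) ∧
        ∀ x y : J → Option A, (∀ j, x j = none ↔ y j = none) →
          C (blockConfig ℓ x) = C (blockConfig ℓ y) := by
  obtain ⟨q, ⟨e⟩⟩ := Finite.exists_equiv_fin J
  obtain ⟨n, hn⟩ := exists_lines_fin A q κ
  refine ⟨n, fun C => ?_⟩
  obtain ⟨ℓ, h₀, h⟩ := hn fun ω => C (ω ∘ e)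
  refine ⟨ℓ ∘ e, fun j => h₀ (e j), fun x y hxy => ?_⟩
  have := h (x ∘ e.symm) (y ∘ e.symm) fun j => hxy _
  have hc : ∀ x : J → Option A, blockConfig ℓ (x ∘ e.symm) ∘ e = blockConfig (ℓ ∘ e) x := by
    intro x
    funext j
    simp [blockConfig]
  rwa [hc, hc] at this

end Blocks

/-! ### The finite Ramsey theorem -/

/-- **Ramsey's theorem** for colorings of the `K`-element subsets. -/
theorem exists_homogeneous (r K M : ℕ) : ∃ N, ∀ X : Finset ℕ, N ≤ X.card →
    ∀ χ : Finset ℕ → Fin (r + 1), ∃ Y ⊆ X, Y.card = M ∧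
      ∃ c, ∀ S ⊆ Y, S.card = K → χ S = c := by
  induction K generalizing M with
  | zero =>
    refine ⟨M, fun X hX χ => ?_⟩
    obtain ⟨Y, hY, hYM⟩ := Finset.exists_subset_card_eq hX
    exact ⟨Y, hY, hYM, χ ∅, fun S _ hS => by rw [Finset.card_eq_zero.1 hS]⟩
  | succ K ih =>
    -- Large sets in which the color of a `(K+1)`-element set depends only on its minimum.
    have key : ∀ j, ∃ N, ∀ X : Finset ℕ, N ≤ X.card → ∀ χ : Finset ℕ → Fin (r + 1),
        ∃ Y ⊆ X, Y.card = j ∧ ∃ col : ℕ → Fin (r + 1), ∀ S ⊆ Y, S.card = K →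
          ∀ a ∈ Y, (∀ x ∈ S, a < x) → χ (insert a S) = col a := by
      intro j
      induction j with
      | zero =>
        refine ⟨0, fun X _ χ => ⟨∅, by simp, rfl, fun _ => 0, fun S _ _ a ha => by simp at ha⟩⟩
      | succ j ihj =>
        obtain ⟨N₁, h₁⟩ := ihj
        obtain ⟨N₂, h₂⟩ := ih N₁
        refine ⟨N₂ + 1, fun X hX χ => ?_⟩
        have hne : X.Nonempty := Finset.card_pos.1 (by omega)
        have hmin := X.min'_mem hne
        -- All `K`-element subsets of `Y₁` get the same color once the minimum of `X` is added; the
        -- recursion continues inside `Y₁`.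
        obtain ⟨Y₁, hY₁, hc₁, c, hc⟩ := h₂ (X.erase (X.min' hne))
          (by rw [Finset.card_erase_of_mem hmin]; omega) fun S => χ (insert (X.min' hne) S)
        obtain ⟨Y₂, hY₂, hc₂, col, hcol⟩ := h₁ Y₁ hc₁.ge χ
        have hlt : ∀ y ∈ Y₂, X.min' hne < y := fun y hy =>
          X.min'_lt_of_mem_erase_min' hne (hY₁ (hY₂ hy))
        have hnot : X.min' hne ∉ Y₂ := fun h => lt_irrefl _ (hlt _ h)
        refine ⟨insert (X.min' hne) Y₂, ?_, by rw [Finset.card_insert_of_notMem hnot, hc₂],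
          Function.update col (X.min' hne) c, ?_⟩
        · intro y hy
          rcases Finset.mem_insert.1 hy with rfl | hy
          · exact hmin
          · exact Finset.mem_of_mem_erase (hY₁ (hY₂ hy))
        · intro S hS hSK a ha haS
          have hS' : S ⊆ Y₂ := by
            intro x hx
            rcases Finset.mem_insert.1 (hS hx) with rfl | h
            · rcases Finset.mem_insert.1 ha with h' | h'
              · exact absurd (haS _ hx) (by rw [h']; exact lt_irrefl _)
              · exact absurd ((haS _ hx).trans (hlt _ h')) (lt_irrefl _)
            · exact h
          rcases Finset.mem_insert.1 ha with rfl | ha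
          · rw [Function.update_self]
            exact hc S (hS'.trans hY₂) hSK
          · rw [Function.update_of_ne (hlt a ha).ne']
            exact hcol S hS' hSK a ha haS
    -- By the pigeonhole principle `M` of the elements share the color attached to them as minima.
    obtain ⟨N, hN⟩ := key ((r + 1) * M)
    refine ⟨N, fun X hX χ => ?_⟩
    obtain ⟨Y, hY, hYc, col, hcol⟩ := hN X hX χ
    obtain ⟨c, -, hc⟩ := Finset.exists_le_card_fiber_of_mul_le_card_of_maps_to
      (s := Y) (t := Finset.univ) (f := col) (n := M) (by simp)
      Finset.univ_nonempty (by simp [hYc])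
    obtain ⟨Z, hZ, hZM⟩ := Finset.exists_subset_card_eq hc
    have hZY : Z ⊆ Y := hZ.trans (Finset.filter_subset _ _)
    refine ⟨Z, hZY.trans hY, hZM, c, fun S hS hSK => ?_⟩
    have hne : S.Nonempty := Finset.card_pos.1 (by omega)
    have hmin := S.min'_mem hne
    have := hcol (S.erase (S.min' hne)) ((Finset.erase_subset _ _).trans (hS.trans hZY))
      (by rw [Finset.card_erase_of_mem hmin]; omega) _ (hZY (hS hmin))
      fun x hx => S.min'_lt_of_mem_erase_min' hne hx
    rw [Finset.insert_erase hmin] at this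
    rw [this]
    exact (Finset.mem_filter.1 (hZ (hS hmin))).2

/-! ### Inserting a block of levels -/

section Insertion

variable {b : ℕ} {Λ : Type*}

/-- The sequence `t⌢(i)⌢y` with `|t| = P` is moved to `t⌢stem t⌢(i)⌢ext t i⌢y`. -/
def blockPos (P : ℕ) (stem : List (Fin b) → List (Fin b))
    (ext : List (Fin b) → Fin b → List (Fin b)) (u : List (Fin b)) : List (Fin b) :=
  if u.length < P then u else
    u.take P ++ stem (u.take P) ++
      match u.drop P with
      | [] => []
      | i :: y => i :: (ext (u.take P) i ++ y)

variable {P m n : ℕ} {stem : List (Fin b) → List (Fin b)}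
  {ext : List (Fin b) → Fin b → List (Fin b)}

theorem blockPos_of_lt {u : List (Fin b)} (h : u.length < P) : blockPos P stem ext u = u :=
  if_pos h

theorem blockPos_of_eq {t : List (Fin b)} (h : t.length = P) :
    blockPos P stem ext t = t ++ stem t := by
  simp [blockPos, ← h]

theorem blockPos_append_cons {t y : List (Fin b)} {i : Fin b} (h : t.length = P) :
    blockPos P stem ext (t ++ i :: y) = t ++ stem t ++ i :: (ext t i ++ y) := by
  simp [blockPos, ← h]

theorem exists_eq_append_cons {u : List (Fin b)} (h : P < u.length) :
    ∃ t i y, t.length = P ∧ u = t ++ i :: y := by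
  refine ⟨u.take P, u[P], u.drop (P + 1), by simp; omega, ?_⟩
  rw [← List.drop_eq_getElem_cons h, List.take_append_drop]

theorem take_blockPos (u : List (Fin b)) :
    (blockPos P stem ext u).take P = u.take P := by
  by_cases h : u.length < P
  · rw [blockPos_of_lt h]
  · have hl : (u.take P).length = P := by simp; omega
    unfold blockPos
    rw [if_neg h, List.append_assoc]
    exact List.take_left' hl

theorem prefix_of_prefix_blockPos {z v : List (Fin b)} (hz : z <+: blockPos P stem ext v)
    (hlt : z.length ≤ P) : z <+: v := by
  have : z = v.take z.length := calc
    z = ((blockPos P stem ext v).take P).take z.length := by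
      rw [List.take_take, min_eq_left hlt]
      exact List.prefix_iff_eq_take.1 hz
    _ = v.take z.length := by rw [take_blockPos, List.take_take, min_eq_left hlt]
  rw [this]
  exact List.take_prefix _ _

theorem length_blockPos (hlen : ∀ t i, t.length = P → (stem t).length + 1 + (ext t i).length = n)
    {u : List (Fin b)} (h : P < u.length) : (blockPos P stem ext u).length + 1 = u.length + n := by
  obtain ⟨t, i, y, ht, rfl⟩ := exists_eq_append_cons h
  rw [blockPos_append_cons ht]
  have := hlen t i ht
  simp
  omega

theorem length_stem_lt [NeZero b]
    (hlen : ∀ t i, t.length = P → (stem t).length + 1 + (ext t i).length = n)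
    {t : List (Fin b)} (h : t.length = P) : (stem t).length < n := by
  have := hlen t 0 h
  omega

theorem isTreeMap_blockPos (P m : ℕ) (stem : List (Fin b) → List (Fin b))
    (ext : List (Fin b) → Fin b → List (Fin b)) : IsTreeMap m (blockPos P stem ext) := by
  intro u i _
  rcases lt_trichotomy u.length P with h | h | h
  · rw [blockPos_of_lt h]
    rcases Nat.lt_or_ge (u.length + 1) P with h' | h'
    · rw [blockPos_of_lt (by simpa using h')]
    · rw [blockPos_of_eq (by simp; omega)]
      exact List.prefix_append _ _
  · rw [blockPos_of_eq h, blockPos_append_cons h]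
    simp
  · obtain ⟨t, j, y, ht, rfl⟩ := exists_eq_append_cons h
    rw [show t ++ j :: y ++ [i] = t ++ j :: (y ++ [i]) by simp, blockPos_append_cons ht,
      blockPos_append_cons ht]
    simp

theorem blockPos_injective (P : ℕ) (stem : List (Fin b) → List (Fin b))
    (ext : List (Fin b) → Fin b → List (Fin b)) :
    Function.Injective (blockPos P stem ext) := fun u v h =>
  (isTreeMap_blockPos P (u.length + v.length + 1) stem ext).injOn (by omega) (by omega) h

theorem levelMono_blockPos [NeZero b] (m : ℕ)
    (hlen : ∀ t i, t.length = P → (stem t).length + 1 + (ext t i).length = n) :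
    LevelMono m (blockPos P stem ext) := by
  intro u v huv _
  rcases lt_trichotomy u.length P with h | h | h
  · rw [blockPos_of_lt h]
    rcases lt_trichotomy v.length P with h' | h' | h'
    · rwa [blockPos_of_lt h']
    · rw [blockPos_of_eq h', List.length_append]
      omega
    · have := length_blockPos hlen h'
      have : 0 < n := (Nat.zero_le _).trans_lt (length_stem_lt hlen
        (t := List.replicate P 0) (by simp))
      omega
  · rw [blockPos_of_eq h, List.length_append]
    have := length_blockPos hlen (h ▸ huv)
    have := length_stem_lt hlen h
    omega
  · have := length_blockPos hlen h
    have := length_blockPos hlen (h.trans huv)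
    omega

/-- Above the block `blockPos` only copies entries, so an initial segment reaching past the block is
again an image. This carries agreement of two words past the block. -/
theorem exists_of_prefix_blockPos [NeZero b]
    (hlen : ∀ t i, t.length = P → (stem t).length + 1 + (ext t i).length = n)
    {z v : List (Fin b)} (hz : z <+: blockPos P stem ext v) (hle : P + n ≤ z.length) :
    ∃ u, u <+: v ∧ P < u.length ∧ z = blockPos P stem ext u := by
  have hzl := hz.length_le
  have hv : P < v.length := by
    by_contra hv
    rcases (not_lt.1 hv).lt_or_eq with h | h
    · rw [blockPos_of_lt h] at hzl
      omega
    · rw [blockPos_of_eq h, List.length_append] at hzl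
      have := length_stem_lt hlen h
      omega
  obtain ⟨t, i, y, ht, rfl⟩ := exists_eq_append_cons hv
  have hl := hlen t i ht
  have hrw : ∀ y, blockPos P stem ext (t ++ i :: y) = (t ++ stem t ++ i :: ext t i) ++ y := by
    intro y
    rw [blockPos_append_cons ht]
    simp
  rw [hrw] at hz
  obtain ⟨y', rfl⟩ := List.prefix_of_prefix_length_le (List.prefix_append _ y) hz
    (by simp; omega)
  rw [List.prefix_append_right_inj] at hz
  exact ⟨t ++ i :: y', by simpa using hz, by simp; omega, (hrw _).symm⟩

open Classical in
/-- The word with first occurrences `blockPos P stem ext`, which is the identity on the first `P`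
levels and has the values `val` on the next `n` levels. -/
noncomputable def blockWord (a₀ : Λ) (P n m : ℕ) (stem : List (Fin b) → List (Fin b))
    (ext : List (Fin b) → Fin b → List (Fin b)) (val : Word b Λ) : Word b Λ := fun z =>
  if z.length < P then Sum.inr z else
    if z.length < P + n then val z else
      if h : ∃ u, P < u.length ∧ u.length < m ∧ z = blockPos P stem ext u then
        Sum.inr h.choose else Sum.inl a₀

variable {a₀ : Λ} {val : Word b Λ}

theorem blockWord_of_lt {z : List (Fin b)} (h : z.length < P) :
    blockWord a₀ P n m stem ext val z = Sum.inr z := by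
  simp [blockWord, h]

theorem blockWord_of_mem_block {z : List (Fin b)} (h : P ≤ z.length) (h' : z.length < P + n) :
    blockWord a₀ P n m stem ext val z = val z := by
  simp [blockWord, h', not_lt.2 h]

theorem blockWord_blockPos
    (hlen : ∀ t i, t.length = P → (stem t).length + 1 + (ext t i).length = n)
    {u : List (Fin b)} (h : P < u.length) (hu : u.length < m) :
    blockWord a₀ P n m stem ext val (blockPos P stem ext u) = Sum.inr u := by
  have hl := length_blockPos hlen h
  have hex : ∃ v, P < v.length ∧ v.length < m ∧ blockPos P stem ext u = blockPos P stem ext v :=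
    ⟨u, h, hu, rfl⟩
  unfold blockWord
  rw [if_neg (by omega), if_neg (by omega), dif_pos hex]
  congr 1
  exact (blockPos_injective _ _ _ hex.choose_spec.2.2).symm

theorem blockWord_of_inr {z u : List (Fin b)} (hz : P + n ≤ z.length)
    (h : blockWord a₀ P n m stem ext val z = Sum.inr u) :
    P < u.length ∧ u.length < m ∧ z = blockPos P stem ext u := by
  unfold blockWord at h
  rw [if_neg (by omega), if_neg (by omega)] at h
  split_ifs at h with hex
  obtain rfl := Sum.inr_injective h
  exact hex.choose_spec

/-- The two conditions on `val` say that each `v_t` with `|t| = P` occurs at the end of its stem and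
that no variable occurs in the block before its assigned position. One level becomes `n` levels,
whence the bound `m + n ≤ N + 1`. -/
theorem isEmb_blockWord [NeZero b] (hPm : P < m)
    (hlen : ∀ t i, t.length = P → (stem t).length + 1 + (ext t i).length = n)
    (hval : ∀ t, t.length = P → val (t ++ stem t) = Sum.inr t)
    (hval' : ∀ z u, P ≤ z.length → z.length < P + n → val z = Sum.inr u →
      u.length ≤ P ∧ blockPos P stem ext u <+: z) {N : ℕ} (hN : m + n ≤ N + 1) :
    IsEmb a₀ m N (blockWord a₀ P n m stem ext val) (blockPos P stem ext) where
  apply_pos u hu := by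
    rcases lt_trichotomy u.length P with h | h | h
    · rw [blockPos_of_lt h, blockWord_of_lt h]
    · rw [blockPos_of_eq h, blockWord_of_mem_block (by simp; omega)
        (by have := length_stem_lt hlen h; simp; omega), hval u h]
    · exact blockWord_blockPos hlen h hu
  of_inr z u hz := by
    rcases Nat.lt_or_ge z.length P with h | h
    · rw [blockWord_of_lt h] at hz
      obtain rfl := Sum.inr_injective hz
      exact ⟨h.trans hPm, by rw [blockPos_of_lt h]⟩
    · rcases Nat.lt_or_ge z.length (P + n) with h' | h'
      · rw [blockWord_of_mem_block h h'] at hz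
        have := hval' z u h h' hz
        exact ⟨by omega, this.2⟩
      · obtain ⟨-, h2, rfl⟩ := blockWord_of_inr h' hz
        exact ⟨h2, List.prefix_rfl⟩
  treeMap := isTreeMap_blockPos _ _ _ _
  const z hz := by
    cases h : blockWord a₀ P n m stem ext val z with
    | inr u =>
      obtain ⟨h1, h2, rfl⟩ := blockWord_of_inr (by omega) h
      have := length_blockPos hlen h1
      omega
    | inl a =>
      unfold blockWord at h
      rw [if_neg (by omega), if_neg (by omega)] at h
      split_ifs at h with hex
      exact h.symm

end Insertion

/-! ### Making a coloring insensitive to the values that are not below a variable -/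

section Dead

variable {b : ℕ} {Λ : Type*}

theorem blockPos_congr {P : ℕ} {stem stem' : List (Fin b) → List (Fin b)}
    {ext ext' : List (Fin b) → Fin b → List (Fin b)} {u : List (Fin b)}
    (h : P ≤ u.length → stem (u.take P) = stem' (u.take P) ∧ ext (u.take P) = ext' (u.take P)) :
    blockPos P stem ext u = blockPos P stem' ext' u := by
  rcases Nat.lt_or_ge u.length P with hu | hu
  · rw [blockPos_of_lt hu, blockPos_of_lt hu]
  · unfold blockPos
    rw [(h hu).1, (h hu).2]

/-- The first place where a line varies. -/
noncomputable def firstNone {A : Type*} (l : ℕ → Option A) : ℕ := sInf {i | l i = none}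

theorem firstNone_spec {A : Type*} {l : ℕ → Option A} {n : ℕ} (h : ∃ i < n, l i = none) :
    firstNone l < n ∧ l (firstNone l) = none := by
  obtain ⟨i, hi, hl⟩ := h
  exact ⟨(Nat.sInf_le hl).trans_lt hi, Nat.sInf_mem (s := {i | l i = none}) ⟨i, hl⟩⟩

theorem firstNone_le {A : Type*} {l : ℕ → Option A} {i : ℕ} (h : l i = none) :
    firstNone l ≤ i := Nat.sInf_le h

/-- A letter of `Λ ⊕ Fin P`, read at `t`, stands for a letter of `Λ` or for one of the variables
of the predecessors of `t`. -/
def decode {P : ℕ} (t : List (Fin b)) (a : Λ ⊕ Fin P) : Λ ⊕ List (Fin b) :=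
  Sum.map id (fun d : Fin P => t.take d) a

theorem length_lt_of_decode {P : ℕ} {t u : List (Fin b)} {a : Λ ⊕ Fin P}
    (h : decode t a = Sum.inr u) : u.length < P ∧ u <+: t := by
  cases a with
  | inl a => simp [decode] at h
  | inr d =>
    obtain rfl : t.take d = u := Sum.inr_injective h
    exact ⟨by simp, List.take_prefix _ _⟩

/-- The letter of the word `h` at `t`, where the variables are named by the lengths of their first
occurrences. -/
def wordLetter (a₀ : Λ) (P : ℕ) (h : Word b Λ) (χ : List (Fin b) → List (Fin b))
    (t : List (Fin b)) : Λ ⊕ Fin P :=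
  match h t with
  | Sum.inl a => Sum.inl a
  | Sum.inr s => if hs : (χ s).length < P then Sum.inr ⟨(χ s).length, hs⟩ else Sum.inl a₀

open Classical in
/-- The letter of the word `h` at `t`, or `none` if `t` is below some `χ s`. -/
noncomputable def deadLetter (a₀ : Λ) (k P : ℕ) (h : Word b Λ)
    (χ : List (Fin b) → List (Fin b)) (t : List (Fin b)) : Option (Λ ⊕ Fin P) :=
  if ∃ s, s.length < k ∧ t <+: χ s then none else some (wordLetter a₀ P h χ t)

section

variable {a₀ : Λ} {k P m : ℕ} {h h' : Word b Λ} {χ : List (Fin b) → List (Fin b)}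

/-- Unless `t` is itself a first occurrence, a variable at `t` first occurs at a proper initial
segment of `t`, which its length determines. The default `a₀` in `wordLetter` is then never reached.
-/
theorem elim_decode_wordLetter (hh : IsEmb a₀ k m h χ) {t : List (Fin b)}
    (ht : t.length = P) (hne : ∀ s, s.length < k → (χ s).length = P → χ s ≠ t) :
    Sum.elim Sum.inl h (decode t (wordLetter a₀ P h χ t)) = h t := by
  unfold wordLetter
  cases hht : h t with
  | inl a => simp [decode]
  | inr s =>
    obtain ⟨hs, hst⟩ := hh.of_inr t s hht
    have hlt : (χ s).length < P := by
      rw [← ht]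
      refine lt_of_le_of_ne hst.length_le fun he => hne s hs (he.trans ht) (hst.eq_of_length he)
    simp [hlt, decode, take_eq_of_prefix hst, hh.apply_pos s hs]

theorem deadLetter_eq_none_iff {t : List (Fin b)} :
    deadLetter a₀ k P h χ t = none ↔ ∃ s, s.length < k ∧ t <+: χ s := by
  unfold deadLetter
  split_ifs with h1 <;> simp [h1]

theorem elim_decode_of_deadLetter (hh : IsEmb a₀ k m h χ) {t : List (Fin b)} {a : Λ ⊕ Fin P}
    (ht : t.length = P) (ha : deadLetter a₀ k P h χ t = some a) :
    Sum.elim Sum.inl h (decode t a) = h t := by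
  unfold deadLetter at ha
  split_ifs at ha with hd
  rw [Option.some_inj] at ha
  subst ha
  exact elim_decode_wordLetter hh ht fun s hs _ he => hd ⟨s, hs, by rw [he]⟩

theorem elim_decode_congr (hlt : ∀ z : List (Fin b), z.length < P → h z = h' z)
    (t : List (Fin b)) (a : Λ ⊕ Fin P) :
    Sum.elim Sum.inl h (decode t a) = Sum.elim Sum.inl h' (decode t a) := by
  cases hd : decode t a with
  | inl a => rfl
  | inr u => exact hlt u (length_lt_of_decode hd).1

end

/-! ### Blocks of chains, one Hales–Jewett line for each node -/

variable [NeZero b]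

/-- The values on the chains `t, t⌢(0), t⌢(0,0), …` given by the lines `ℓ t`. -/
noncomputable def chainVal (a₀ : Λ) (P : ℕ) (ℓ : List (Fin b) → ℕ → Option (Λ ⊕ Fin P)) :
    Word b Λ := fun z =>
  if z.drop P = List.replicate (z.length - P) 0 then
    match ℓ (z.take P) (z.length - P) with
    | some a => decode (z.take P) a
    | none => Sum.inr (z.take P)
  else Sum.inl a₀

/-- The part before the first varying place of the chain above `t`. -/
noncomputable def chainStem {P : ℕ} (ℓ : List (Fin b) → ℕ → Option (Λ ⊕ Fin P))
    (t : List (Fin b)) : List (Fin b) := List.replicate (firstNone (ℓ t)) 0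

/-- The part after the first varying place of the chain above `t`. -/
noncomputable def chainExt {P : ℕ} (n : ℕ) (ℓ : List (Fin b) → ℕ → Option (Λ ⊕ Fin P))
    (t : List (Fin b)) (_ : Fin b) : List (Fin b) := List.replicate (n - 1 - firstNone (ℓ t)) 0

section

variable {a₀ : Λ} {P n m N : ℕ} {ℓ : List (Fin b) → ℕ → Option (Λ ⊕ Fin P)}

theorem length_chain (hℓ : ∀ t, t.length = P → ∃ i < n, ℓ t i = none) (t : List (Fin b))
    (i : Fin b) (ht : t.length = P) :
    (chainStem ℓ t).length + 1 + (chainExt n ℓ t i).length = n := by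
  have := (firstNone_spec (hℓ t ht)).1
  simp [chainStem, chainExt]
  omega

theorem isEmb_chain (a₀ : Λ) (hPm : P < m) (hN : m + n ≤ N + 1)
    (hℓ : ∀ t, t.length = P → ∃ i < n, ℓ t i = none) :
    IsEmb a₀ m N (blockWord a₀ P n m (chainStem ℓ) (chainExt n ℓ) (chainVal a₀ P ℓ))
      (blockPos P (chainStem ℓ) (chainExt n ℓ)) := by
  refine isEmb_blockWord hPm (length_chain hℓ) ?_ ?_ hN
  · rintro t rfl
    simp [chainVal, chainStem, (firstNone_spec (hℓ t rfl)).2]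
  · intro z u hz hz' h
    unfold chainVal at h
    split_ifs at h with hd
    have htl : (z.take P).length = P := by simp; omega
    cases hl : ℓ (z.take P) (z.length - P) with
    | some a =>
      simp only [hl] at h
      obtain ⟨h1, h2⟩ := length_lt_of_decode h
      exact ⟨h1.le, by rw [blockPos_of_lt h1]; exact h2.trans (List.take_prefix _ _)⟩
    | none =>
      simp only [hl, Sum.inr.injEq] at h
      subst h
      refine ⟨htl.le, ?_⟩
      rw [blockPos_of_eq htl]
      conv_rhs => rw [← List.take_append_drop P z]
      rw [List.prefix_append_right_inj, hd, chainStem]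
      exact List.prefix_replicate_iff.2 ⟨by simpa using firstNone_le hl, by simp⟩

end

section

variable {a₀ : Λ} {k P n m N : ℕ} {ℓ ℓ' : List (Fin b) → ℕ → Option (Λ ⊕ Fin P)}
  {h h' : Word b Λ} {χ : List (Fin b) → List (Fin b)}

/-- The value of the substituted word in the block above `t`, in terms of the configuration. -/
theorem elim_chainVal (hh : IsEmb a₀ k m h χ) {z : List (Fin b)} (hz : P ≤ z.length)
    (hd : z.drop P = List.replicate (z.length - P) 0) :
    Sum.elim Sum.inl h (chainVal a₀ P ℓ z) =
      match blockConfig ℓ (deadLetter a₀ k P h χ) (z.take P) with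
      | Sum.inl w => Sum.elim Sum.inl h (decode (z.take P) (w (z.length - P)))
      | Sum.inr l => match l (z.length - P) with
        | some a => Sum.elim Sum.inl h (decode (z.take P) a)
        | none => h (z.take P) := by
  have htl : (z.take P).length = P := by simp; omega
  unfold chainVal
  rw [if_pos hd]
  unfold blockConfig
  cases hx : deadLetter a₀ k P h χ (z.take P) with
  | none =>
    cases hl : ℓ (z.take P) (z.length - P) <;> simp [hl]
  | some a =>
    cases hl : ℓ (z.take P) (z.length - P) with
    | some a' => simp [hl]
    | none => simpa [hl] using (elim_decode_of_deadLetter hh htl hx).symm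

/-- The configuration determines the lines above the live nodes, hence the positions, and the words
written above the dead nodes. The other data in the block come from `h` below level `P` and at live
nodes, where `h` and `h'` agree. -/
theorem comp_chain_congr (hPm : P < m) (hN : m + n = N + 1)
    (hℓ : ∀ t, t.length = P → ∃ i < n, ℓ t i = none)
    (hℓ' : ∀ t, t.length = P → ∃ i < n, ℓ' t i = none)
    (hh : IsEmb a₀ k m h χ) (hh' : IsEmb a₀ k m h' χ)
    (hlt : ∀ z : List (Fin b), z.length < P → h z = h' z) (hlive : AgreeBelow k χ h h')
    (hconf : ∀ t, t.length = P → blockConfig ℓ (deadLetter a₀ k P h χ) t =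
      blockConfig ℓ' (deadLetter a₀ k P h' χ) t) :
    ∃ ψ, IsEmb a₀ k N (comp (blockWord a₀ P n m (chainStem ℓ) (chainExt n ℓ)
        (chainVal a₀ P ℓ)) h) ψ ∧
      IsEmb a₀ k N (comp (blockWord a₀ P n m (chainStem ℓ') (chainExt n ℓ')
        (chainVal a₀ P ℓ')) h') ψ ∧
      (∀ z : List (Fin b), z.length < P + n →
        comp (blockWord a₀ P n m (chainStem ℓ) (chainExt n ℓ) (chainVal a₀ P ℓ)) h z =
        comp (blockWord a₀ P n m (chainStem ℓ') (chainExt n ℓ') (chainVal a₀ P ℓ')) h' z) ∧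
      AgreeBelow k ψ
        (comp (blockWord a₀ P n m (chainStem ℓ) (chainExt n ℓ) (chainVal a₀ P ℓ)) h)
        (comp (blockWord a₀ P n m (chainStem ℓ') (chainExt n ℓ') (chainVal a₀ P ℓ')) h') := by
  have hline : ∀ t s, t.length = P → s.length < k → t <+: χ s → ℓ t = ℓ' t := by
    intro t s ht hs hts
    have := hconf t ht
    unfold blockConfig at this
    rw [deadLetter_eq_none_iff.2 ⟨s, hs, hts⟩, deadLetter_eq_none_iff.2 ⟨s, hs, hts⟩] at this
    exact Sum.inr_injective this
  have hpos : ∀ u s, s.length < k → u <+: χ s →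
      blockPos P (chainStem ℓ) (chainExt n ℓ) u = blockPos P (chainStem ℓ') (chainExt n ℓ') u := by
    intro u s hs hus
    refine blockPos_congr fun hu => ?_
    have := hline (u.take P) s (by simp; omega) hs ((List.take_prefix _ _).trans hus)
    unfold chainStem chainExt
    rw [this]
    exact ⟨rfl, rfl⟩
  have hblock : ∀ z : List (Fin b), z.length < P + n →
        comp (blockWord a₀ P n m (chainStem ℓ) (chainExt n ℓ) (chainVal a₀ P ℓ)) h z =
        comp (blockWord a₀ P n m (chainStem ℓ') (chainExt n ℓ') (chainVal a₀ P ℓ')) h' z := by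
    intro z hz
    rcases Nat.lt_or_ge z.length P with hzP | hzP
    · rw [comp_of_inr (blockWord_of_lt hzP), comp_of_inr (blockWord_of_lt hzP), hlt z hzP]
    · unfold comp
      rw [blockWord_of_mem_block hzP hz, blockWord_of_mem_block hzP hz]
      by_cases hd : z.drop P = List.replicate (z.length - P) 0
      · have htl : (z.take P).length = P := by simp; omega
        rw [elim_chainVal hh hzP hd, elim_chainVal hh' hzP hd, ← hconf _ htl]
        cases hc : blockConfig ℓ (deadLetter a₀ k P h χ) (z.take P) with
        | inl w => exact elim_decode_congr hlt _ _
        | inr l =>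
          dsimp only
          cases l (z.length - P) with
          | some a => exact elim_decode_congr hlt _ _
          | none =>
            have : deadLetter a₀ k P h χ (z.take P) = none := by
              unfold blockConfig at hc
              cases hx : deadLetter a₀ k P h χ (z.take P) with
              | none => rfl
              | some a => simp [hx] at hc
            obtain ⟨s, hs, hts⟩ := deadLetter_eq_none_iff.1 this
            exact hlive _ s hs hts
      · simp [chainVal, hd]
  refine ⟨_, (isEmb_chain a₀ hPm hN.le hℓ).comp hh, ((isEmb_chain a₀ hPm hN.le hℓ').comp
    hh').congr_pos fun s hs => (hpos _ s hs List.prefix_rfl).symm, hblock, ?_⟩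
  intro z s hs hzs
  rcases Nat.lt_or_ge z.length (P + n) with hz | hz
  · exact hblock z hz
  · obtain ⟨u, hu, hPu, rfl⟩ := exists_of_prefix_blockPos (length_chain hℓ) hzs hz
    have hum : u.length < m := hu.length_le.trans_lt (hh.length_lt hs)
    rw [comp_of_inr (blockWord_blockPos (length_chain hℓ) hPu hum), hpos u s hs hu,
      comp_of_inr (blockWord_blockPos (length_chain hℓ') hPu hum), hlive u s hs hu]

end

/-- Here `P` counts the levels on which the words may be assumed equal and `e` the levels still to
be stretched. Stretching level `P` to `n` levels makes the words equal on `P + n` levels, with `e -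
1` levels left. -/
theorem exists_insensitive_of_agree [Finite Λ] (a₀ : Λ) (k r e : ℕ) :
    ∀ P, ∃ n, ∀ c : Word b Λ → Fin r, ∃ f φ, IsEmb a₀ (P + e) n f φ ∧ LevelMono (P + e) φ ∧
      ∀ h h' χ, IsEmb a₀ k (P + e) h χ → IsEmb a₀ k (P + e) h' χ →
        (∀ z : List (Fin b), z.length < P → h z = h' z) → AgreeBelow k χ h h' →
          c (comp f h) = c (comp f h') := by
  classical
  induction e with
  | zero =>
    intro P
    refine ⟨P, fun c => ?_⟩
    obtain ⟨f, hf, -⟩ := IsEmb.exists_of_treeMap (n := P) a₀ (b := b) (m := P) (φ := id)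
      (fun t i _ => List.prefix_rfl) (fun t ht => ht)
    refine ⟨f, id, hf, fun t t' h _ => h, fun h h' χ _ _ hlt _ => ?_⟩
    congr 1
    funext z
    unfold comp
    cases hz : f z with
    | inl a => rfl
    | inr t => exact hlt t (hf.of_inr z t hz).1
  | succ e ih =>
    intro P
    have hPm : P < P + (e + 1) := by omega
    generalize hm : P + (e + 1) = m at hPm
    have hfinJ : Finite {t : List (Fin b) // t.length = P} :=
      (List.finite_length_eq (Fin b) P).to_subtype
    have hfinH : Finite {h : Word b Λ // ∃ χ, IsEmb a₀ k m h χ} :=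
      (finite_isEmb a₀ k m).to_subtype
    let _ : Inhabited (Λ ⊕ Fin P) := ⟨Sum.inl a₀⟩
    obtain ⟨n, hn⟩ := exists_lines (Λ ⊕ Fin P) {t : List (Fin b) // t.length = P}
      ({h : Word b Λ // ∃ χ, IsEmb a₀ k m h χ} → Fin r)
    obtain ⟨N, hN⟩ := ih (P + n)
    refine ⟨N, fun c => ?_⟩
    obtain ⟨f₁, φ₁, hf₁, hmono₁, hins⟩ := hN c
    let F : (List (Fin b) → ℕ → Option (Λ ⊕ Fin P)) → Word b Λ := fun ℓ =>
      blockWord a₀ P n m (chainStem ℓ) (chainExt n ℓ) (chainVal a₀ P ℓ)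
    -- `R ω h g` says that `g` realizes the configuration `ω` over the reference word `h`: it comes
    -- from some `h'` that has the data of `h` below level `P` and at live positions, but arbitrary
    -- dead letters.
    let R : ({t : List (Fin b) // t.length = P} → (ℕ → Λ ⊕ Fin P) ⊕ (ℕ → Option (Λ ⊕ Fin P))) →
        (h : {h : Word b Λ // ∃ χ, IsEmb a₀ k m h χ}) → Word b Λ → Prop := fun ω h g =>
      ∃ ℓ h', (∀ t, t.length = P → ∃ i < n, ℓ t i = none) ∧ IsEmb a₀ k m h' h.2.choose ∧
        (∀ z : List (Fin b), z.length < P → h.1 z = h' z) ∧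
        AgreeBelow k h.2.choose h.1 h' ∧
        (∀ t, ω t = blockConfig ℓ (deadLetter a₀ k P h' h.2.choose) t.1) ∧ g = comp (F ℓ) h'
    have hR : ∀ ω h g g', R ω h g → R ω h g' → c (comp f₁ g) = c (comp f₁ g') := by
      rintro ω h _ _ ⟨ℓ, h₁, hℓ, hh₁, hlt₁, hag₁, hω₁, rfl⟩ ⟨ℓ', h₂, hℓ', hh₂, hlt₂, hag₂, hω₂, rfl⟩
      obtain ⟨ψ, h3, h4, h5, h6⟩ := comp_chain_congr (N := P + n + e) hPm (by omega) hℓ hℓ' hh₁ hh₂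
        (fun z hz => (hlt₁ z hz).symm.trans (hlt₂ z hz))
        (fun z s hs hz => (hag₁ z s hs hz).symm.trans (hag₂ z s hs hz))
        (fun t ht => (hω₁ ⟨t, ht⟩).symm.trans (hω₂ ⟨t, ht⟩))
      exact hins _ _ ψ h3 h4 h5 h6
    -- A configuration receives the color of any realization; by `hR` the choice is immaterial. The
    -- color of a configuration without realization plays no role.
    obtain ⟨ℓ₀, hℓ₀, hC⟩ := hn fun ω h =>
      if hg : ∃ g, R ω h g then c (comp f₁ hg.choose) else c h.1
    let ℓ : List (Fin b) → ℕ → Option (Λ ⊕ Fin P) := fun t =>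
      if ht : t.length = P then ℓ₀ ⟨t, ht⟩ else fun _ => none
    have hℓeq : ∀ t : {t : List (Fin b) // t.length = P}, ℓ t.1 = ℓ₀ t := fun t => by
      simp [ℓ, t.2]
    have hℓ : ∀ t, t.length = P → ∃ i < n, ℓ t i = none := fun t ht => by
      rw [hℓeq ⟨t, ht⟩]
      exact hℓ₀ ⟨t, ht⟩
    have hF : IsEmb a₀ m (P + n + e) (F ℓ) (blockPos P (chainStem ℓ) (chainExt n ℓ)) :=
      isEmb_chain a₀ hPm (by omega) hℓ
    refine ⟨comp f₁ (F ℓ), _, hf₁.comp hF, hmono₁.comp (levelMono_blockPos m (length_chain hℓ))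
      fun s hs => hF.length_lt hs, ?_⟩
    intro h h' χ hh hh' hlt hlive
    let H : {h : Word b Λ // ∃ χ, IsEmb a₀ k m h χ} := ⟨h, χ, hh⟩
    have hχ : ∀ s, s.length < k → χ s = H.2.choose s := fun s hs =>
      hh.pos_unique H.2.choose_spec hs
    have hcol : ∀ g, IsEmb a₀ k m g χ → (∀ z : List (Fin b), z.length < P → h z = g z) →
        AgreeBelow k χ h g → c (comp f₁ (comp (F ℓ) g)) =
        (fun ω (h : {h : Word b Λ // ∃ χ, IsEmb a₀ k m h χ}) =>
          if hg : ∃ g, R ω h g then c (comp f₁ hg.choose) else c h.1)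
          (blockConfig ℓ₀ fun t => deadLetter a₀ k P g H.2.choose t.1) H := by
      intro g hg hgP hgl
      have hRg : R (blockConfig ℓ₀ fun t => deadLetter a₀ k P g H.2.choose t.1) H
          (comp (F ℓ) g) := by
        refine ⟨ℓ, g, hℓ, hg.congr_pos hχ, hgP, fun z s hs hz => hgl z s hs ?_, fun t => ?_, rfl⟩
        · rwa [hχ s hs]
        · unfold blockConfig
          rw [hℓeq]
      have hex : ∃ g', R (blockConfig ℓ₀ fun t => deadLetter a₀ k P g H.2.choose t.1) H g' :=
        ⟨_, hRg⟩
      dsimp only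
      rw [dif_pos hex]
      exact hR _ _ _ _ hRg hex.choose_spec
    rw [comp_assoc, comp_assoc, hcol h hh (fun _ _ => rfl) (fun _ _ _ _ => rfl),
      hcol h' hh' hlt hlive]
    -- Which nodes are dead depends only on `χ`, which `h` and `h'` share.
    refine congrFun (hC _ _ fun t => ?_) H
    rw [deadLetter_eq_none_iff, deadLetter_eq_none_iff]

theorem exists_deadInsensitive [Finite Λ] (a₀ : Λ) (k r m : ℕ) :
    ∃ n, ∀ c : Word b Λ → Fin r, ∃ f φ, IsEmb a₀ m n f φ ∧ LevelMono m φ ∧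
      DeadInsensitive a₀ k m fun h => c (comp f h) := by
  obtain ⟨n, hn⟩ := exists_insensitive_of_agree (b := b) a₀ k r m 0
  refine ⟨n, fun c => ?_⟩
  obtain ⟨f, φ, hf, hm, h⟩ := hn c
  rw [Nat.zero_add] at hf hm h
  exact ⟨f, φ, hf, hm, fun g g' χ hg hg' hag => h g g' χ hg hg' (by simp) hag⟩

end Dead

/-! ### Making a coloring depend only on the lengths of the first occurrences -/

section Level

variable {b : ℕ} {Λ : Type*}

/-- The sequences `χ s` have different lengths. -/
def LevelInj (k : ℕ) (χ : List (Fin b) → List (Fin b)) : Prop :=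
  ∀ s s', s.length < k → s'.length < k → (χ s).length = (χ s').length → s = s'

/-- The length of `φ u` is determined by the length of `u`. -/
def LevelUniform (m : ℕ) (φ : List (Fin b) → List (Fin b)) : Prop :=
  ∀ u u', u.length = u'.length → u'.length < m → (φ u).length = (φ u').length

/-- At the level of a first occurrence `χ s`, the paths to the other first occurrences have the
value `a₀` and the direction `0`. -/
def Neat [NeZero b] (a₀ : Λ) (k : ℕ) (h : Word b Λ) (χ : List (Fin b) → List (Fin b)) : Prop :=
  ∀ s s' v, s.length < k → s'.length < k → v.length = (χ s).length → v <+: χ s' → v ≠ χ s →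
    v ≠ χ s' → v ++ [0] <+: χ s' ∧ h v = Sum.inl a₀

theorem LevelInj.comp {k m : ℕ} {φ χ : List (Fin b) → List (Fin b)} (hφ : LevelMono m φ)
    (hχ : LevelInj k χ) (hlt : ∀ s, s.length < k → (χ s).length < m) : LevelInj k (φ ∘ χ) := by
  intro s s' hs hs' h
  rcases lt_trichotomy (χ s).length (χ s').length with h1 | h1 | h1
  · exact absurd h (hφ _ _ h1 (hlt _ hs')).ne
  · exact hχ s s' hs hs' h1
  · exact absurd h (hφ _ _ h1 (hlt _ hs)).ne'

/-- By level uniformity, the path to `φ (χ s')` crosses the level of `φ (χ s)` at some `φ v`, where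
`v` is the crossing in the original tree; there `f` has the variable `v_v`, which `h` replaces by
`a₀`. -/
theorem Neat.comp [NeZero b] {a₀ : Λ} {k m n : ℕ} {f h : Word b Λ}
    {φ χ : List (Fin b) → List (Fin b)} (hf : IsEmb a₀ m n f φ) (hmono : LevelMono m φ)
    (hunif : LevelUniform m φ) (hh : IsEmb a₀ k m h χ) (hinj : LevelInj k χ)
    (hneat : Neat a₀ k h χ) : Neat a₀ k (comp f h) (φ ∘ χ) := by
  intro s s' w hs hs' hw hws hne _
  have hss' : s ≠ s' := by
    rintro rfl
    exact hne (hws.eq_of_length hw)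
  have hlen : (χ s).length ≤ (χ s').length := by
    by_contra hlt
    have := hmono _ _ (not_le.1 hlt) (hh.length_lt hs)
    have := hws.length_le
    simp only [Function.comp] at *
    omega
  have hlt : (χ s).length < (χ s').length :=
    lt_of_le_of_ne hlen fun h => hss' (hinj s s' hs hs' h)
  obtain ⟨v, hv⟩ : ∃ v, v = (χ s').take (χ s).length := ⟨_, rfl⟩
  have hvl : v.length = (χ s).length := by simp [hv, hlen]
  have hvp : v <+: χ s' := hv ▸ List.take_prefix _ _
  have hwv : w = φ v := by
    refine (List.prefix_of_prefix_length_le hws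
      (hf.treeMap.prefix_mono (hh.length_lt hs') hvp) ?_).eq_of_length ?_
    · rw [hunif v _ hvl (hh.length_lt hs)]
      exact hw.le
    · rw [hunif v _ hvl (hh.length_lt hs)]
      exact hw
  have hvs' : v ≠ χ s' := by
    rintro rfl
    omega
  have hvm : v.length < m := hvl ▸ hh.length_lt hs
  subst hwv
  obtain ⟨h1, h2⟩ := hneat s s' v hs hs' hvl hvp (by rintro rfl; exact hne rfl) hvs'
  refine ⟨hf.treeMap.append_prefix (hh.length_lt hs') h1, ?_⟩
  rw [comp_of_inr (hf.apply_pos v hvm), h2]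

/-- The first occurrences of `h` and `h'` have the same lengths, and the paths to them agree
below level `P`, together with the values of the words. -/
structure LevelEquiv (k P : ℕ) (h : Word b Λ) (χ : List (Fin b) → List (Fin b)) (h' : Word b Λ)
    (χ' : List (Fin b) → List (Fin b)) : Prop where
  length_eq : ∀ s, s.length < k → (χ s).length = (χ' s).length
  take_eq : ∀ s, s.length < k → (χ s).take P = (χ' s).take P
  agree : ∀ z s, s.length < k → z.length < P → z <+: χ s → h z = h' z

namespace LevelEquiv

variable {k P : ℕ} {h h' h'' : Word b Λ} {χ χ' χ'' : List (Fin b) → List (Fin b)}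

theorem prefix_of_prefix (H : LevelEquiv k P h χ h' χ') {z s : List (Fin b)} (hs : s.length < k)
    (hz : z.length ≤ P) (hzs : z <+: χ s) : z <+: χ' s := by
  have : z <+: (χ s).take P := List.prefix_take_iff.2 ⟨hzs, hz⟩
  rw [H.take_eq s hs] at this
  exact this.trans (List.take_prefix _ _)

theorem symm (H : LevelEquiv k P h χ h' χ') : LevelEquiv k P h' χ' h χ where
  length_eq s hs := (H.length_eq s hs).symm
  take_eq s hs := (H.take_eq s hs).symm
  agree z s hs hz hzs := by
    have : z <+: (χ' s).take P := List.prefix_take_iff.2 ⟨hzs, hz.le⟩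
    rw [← H.take_eq s hs] at this
    exact (H.agree z s hs hz (this.trans (List.take_prefix _ _))).symm

theorem trans (H : LevelEquiv k P h χ h' χ') (H' : LevelEquiv k P h' χ' h'' χ'') :
    LevelEquiv k P h χ h'' χ'' where
  length_eq s hs := (H.length_eq s hs).trans (H'.length_eq s hs)
  take_eq s hs := (H.take_eq s hs).trans (H'.take_eq s hs)
  agree z s hs hz hzs := (H.agree z s hs hz hzs).trans
    (H'.agree z s hs hz (H.prefix_of_prefix hs hz.le hzs))

theorem of_pos_eq (h : Word b Λ) (hχ : ∀ s, s.length < k → χ s = χ' s) :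
    LevelEquiv k P h χ h χ' where
  length_eq s hs := by rw [hχ s hs]
  take_eq s hs := by rw [hχ s hs]
  agree _ _ _ _ _ := rfl

theorem levelInj (H : LevelEquiv k P h χ h' χ') (hχ : LevelInj k χ) : LevelInj k χ' := by
  intro s s' hs hs' he
  rw [← H.length_eq s hs, ← H.length_eq s' hs'] at he
  exact hχ s s' hs hs' he

end LevelEquiv

/-- A direction and a letter for every sequence of length `P`. -/
abbrev PathLetter (b : ℕ) (Λ : Type*) (P : ℕ) : Type _ :=
  {t : List (Fin b) // t.length = P} → Fin b × (Λ ⊕ Fin P)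

/-! ### Blocks of paths steered by one Hales–Jewett line -/

variable [NeZero b]

/-- The direction and the letter prescribed by `x` at `t`. -/
def PathLetter.eval {P : ℕ} (a₀ : Λ) (x : PathLetter b Λ P) (t : List (Fin b)) :
    Fin b × (Λ ⊕ Fin P) :=
  if ht : t.length = P then x ⟨t, ht⟩ else (0, Sum.inl a₀)

/-- The path above `t` with the directions of the line `ℓ`, the varying directions being `i`. -/
def pathOf {P : ℕ} (a₀ : Λ) (n : ℕ) (ℓ : ℕ → Option (PathLetter b Λ P)) (t : List (Fin b))
    (i : Fin b) : List (Fin b) :=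
  (List.range n).map fun σ => ((ℓ σ).map fun x => (x.eval a₀ t).1).getD i

/-- The part of the path above `t` before the first varying direction. -/
noncomputable def pathStem {P : ℕ} (a₀ : Λ) (n : ℕ) (ℓ : ℕ → Option (PathLetter b Λ P))
    (t : List (Fin b)) : List (Fin b) := (pathOf a₀ n ℓ t 0).take (firstNone ℓ)

/-- The part of the path above `t` after the first varying direction. -/
noncomputable def pathExt {P : ℕ} (a₀ : Λ) (n : ℕ) (ℓ : ℕ → Option (PathLetter b Λ P))
    (t : List (Fin b)) (i : Fin b) : List (Fin b) := (pathOf a₀ n ℓ t i).drop (firstNone ℓ + 1)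

open Classical in
/-- The values on the paths given by the line `ℓ`. -/
noncomputable def pathVal {P : ℕ} (a₀ : Λ) (n : ℕ) (ℓ : ℕ → Option (PathLetter b Λ P)) :
    Word b Λ := fun z =>
  if ∃ i, z.drop P <+: pathOf a₀ n ℓ (z.take P) i then
    match ℓ (z.length - P) with
    | some x => decode (z.take P) (x.eval a₀ (z.take P)).2
    | none => Sum.inr (z.take P)
  else Sum.inl a₀

section

variable {a₀ : Λ} {P n : ℕ} {ℓ : ℕ → Option (PathLetter b Λ P)}

theorem length_pathOf (t : List (Fin b)) (i : Fin b) : (pathOf a₀ n ℓ t i).length = n := by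
  simp [pathOf]

/-- Before the first varying place the directions do not involve `i`, so the `b` paths above `t`
share a stem and split exactly there. -/
theorem pathOf_eq_append (hℓ : ∃ i < n, ℓ i = none) (t : List (Fin b)) (i : Fin b) :
    pathOf a₀ n ℓ t i = pathStem a₀ n ℓ t ++ i :: pathExt a₀ n ℓ t i := by
  obtain ⟨h1, h2⟩ := firstNone_spec hℓ
  have hl : firstNone ℓ < (pathOf a₀ n ℓ t i).length := by rwa [length_pathOf]
  have hst : pathStem a₀ n ℓ t = (pathOf a₀ n ℓ t i).take (firstNone ℓ) := by
    unfold pathStem pathOf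
    refine List.ext_getElem (by simp) fun σ hσ _ => ?_
    have hσ' : σ < firstNone ℓ := by simp at hσ; omega
    cases hx : ℓ σ with
    | none => exact absurd (firstNone_le hx) (not_le.2 hσ')
    | some x => simp [hx]
  have hi : (pathOf a₀ n ℓ t i)[firstNone ℓ] = i := by
    simp [pathOf, h2]
  rw [hst, pathExt]
  conv_lhs => rw [← List.take_append_drop (firstNone ℓ) (pathOf a₀ n ℓ t i),
    List.drop_eq_getElem_cons hl, hi]

theorem length_pathStem (hℓ : ∃ i < n, ℓ i = none) (t : List (Fin b)) :
    (pathStem a₀ n ℓ t).length = firstNone ℓ := by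
  simp [pathStem, length_pathOf, (firstNone_spec hℓ).1.le]

theorem length_path (hℓ : ∃ i < n, ℓ i = none) (t : List (Fin b)) (i : Fin b)
    (_ : t.length = P) :
    (pathStem a₀ n ℓ t).length + 1 + (pathExt a₀ n ℓ t i).length = n := by
  have := length_pathOf (a₀ := a₀) (n := n) (ℓ := ℓ) t i
  rw [pathOf_eq_append hℓ] at this
  simp at this
  omega

theorem blockPos_path (hℓ : ∃ i < n, ℓ i = none) {t y : List (Fin b)} {i : Fin b}
    (ht : t.length = P) :
    blockPos P (pathStem a₀ n ℓ) (pathExt a₀ n ℓ) (t ++ i :: y) =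
      t ++ pathOf a₀ n ℓ t i ++ y := by
  rw [blockPos_append_cons ht, pathOf_eq_append hℓ]
  simp

theorem isEmb_path (a₀ : Λ) {m N : ℕ} (hPm : P < m) (hN : m + n ≤ N + 1)
    (hℓ : ∃ i < n, ℓ i = none) :
    IsEmb a₀ m N (blockWord a₀ P n m (pathStem a₀ n ℓ) (pathExt a₀ n ℓ) (pathVal a₀ n ℓ))
      (blockPos P (pathStem a₀ n ℓ) (pathExt a₀ n ℓ)) := by
  refine isEmb_blockWord hPm (length_path hℓ) ?_ ?_ hN
  · rintro t rfl
    have hex : ∃ i, pathStem a₀ n ℓ t <+: pathOf a₀ n ℓ t i := ⟨0, List.take_prefix _ _⟩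
    simp [pathVal, hex, length_pathStem hℓ, (firstNone_spec hℓ).2]
  · intro z u hz hz' h
    unfold pathVal at h
    split_ifs at h with hd
    have htl : (z.take P).length = P := by simp; omega
    cases hl : ℓ (z.length - P) with
    | some a =>
      simp only [hl] at h
      obtain ⟨h1, h2⟩ := length_lt_of_decode h
      exact ⟨h1.le, by rw [blockPos_of_lt h1]; exact h2.trans (List.take_prefix _ _)⟩
    | none =>
      simp only [hl, Sum.inr.injEq] at h
      subst h
      refine ⟨htl.le, ?_⟩
      rw [blockPos_of_eq htl]
      conv_rhs => rw [← List.take_append_drop P z]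
      rw [List.prefix_append_right_inj]
      obtain ⟨i, hi⟩ := hd
      refine List.prefix_of_prefix_length_le ?_ hi ?_
      · rw [pathOf_eq_append hℓ]
        exact List.prefix_append _ _
      · rw [length_pathStem hℓ]
        simpa using firstNone_le hl

/-- All nodes of level `P` use the same line, so their stems are equally long. This is what lets
`Neat` survive the insertion of the block. -/
theorem levelUniform_path (m : ℕ) (hℓ : ∃ i < n, ℓ i = none) :
    LevelUniform m (blockPos P (pathStem a₀ n ℓ) (pathExt a₀ n ℓ)) := by
  intro u u' huu' _
  rcases lt_trichotomy u.length P with h | h | h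
  · rw [blockPos_of_lt h, blockPos_of_lt (huu' ▸ h), huu']
  · rw [blockPos_of_eq h, blockPos_of_eq (huu' ▸ h), List.length_append, List.length_append,
      length_pathStem hℓ, length_pathStem hℓ, huu']
  · have := length_blockPos (length_path (a₀ := a₀) hℓ) h
    have := length_blockPos (length_path (a₀ := a₀) hℓ) (huu' ▸ h)
    omega

open Classical in
/-- The direction of the paths above `t` to the sequences `χ s`, and the letter at `t`. -/
noncomputable def pathLetter (a₀ : Λ) (k P : ℕ) (h : Word b Λ)
    (χ : List (Fin b) → List (Fin b)) : PathLetter b Λ P := fun t =>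
  (if hi : ∃ i s, s.length < k ∧ t.1 ++ [i] <+: χ s then hi.choose else 0,
    wordLetter a₀ P h χ t.1)

variable {k m : ℕ} {ℓ' : ℕ → Option (PathLetter b Λ P)}
  {h h' : Word b Λ} {χ χ' : List (Fin b) → List (Fin b)}

omit [NeZero b] in
-- A tree map sends meets to meets, so a branching point of the paths to the `χ s` is itself some `χ
-- v`.
theorem direction_unique (hχ : IsTreeMap k χ) {t s s' : List (Fin b)} {i j : Fin b}
    (hP : ∀ s, s.length < k → χ s ≠ t) (hs : s.length < k) (hs' : s'.length < k)
    (hi : t ++ [i] <+: χ s) (hj : t ++ [j] <+: χ s') : i = j := by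
  rcases prefix_trichotomy s s' with h | ⟨c, h⟩ | ⟨v, c, d, hcd, h, h'⟩
  · exact eq_of_append_singleton_prefix (hi.trans (hχ.prefix_mono hs' h)) hj
  · exact eq_of_append_singleton_prefix hi
      (hj.trans (hχ.prefix_mono hs (prefix_of_append_singleton_prefix h)))
  · by_contra hij
    have h1 := hχ.append_prefix hs h
    have h2 := hχ.append_prefix hs' h'
    have hvk : v.length < k := (length_lt_of_append_singleton_prefix h).trans hs
    rcases lt_trichotomy t.length (χ v).length with hl | hl | hl
    · have h3 := List.prefix_of_prefix_length_le hi
        (prefix_of_append_singleton_prefix h1) (by simpa using hl)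
      have h4 := List.prefix_of_prefix_length_le hj
        (prefix_of_append_singleton_prefix h2) (by simpa using hl)
      exact hij (eq_of_append_singleton_prefix h3 h4)
    · exact hP v hvk ((List.prefix_of_prefix_length_le (prefix_of_append_singleton_prefix h1)
        (prefix_of_append_singleton_prefix hi) hl.ge).eq_of_length hl.symm)
    · have h3 := List.prefix_of_prefix_length_le h1
        (prefix_of_append_singleton_prefix hi) (by simpa using hl)
      have h4 := List.prefix_of_prefix_length_le h2
        (prefix_of_append_singleton_prefix hj) (by simpa using hl)
      exact hcd (eq_of_append_singleton_prefix h3 h4)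

theorem pathLetter_eval_fst (hχ : IsTreeMap k χ) {t s : List (Fin b)} {i : Fin b}
    (ht : t.length = P) (hP : ∀ s, s.length < k → (χ s).length ≠ P) (hs : s.length < k)
    (hi : t ++ [i] <+: χ s) : ((pathLetter a₀ k P h χ).eval a₀ t).1 = i := by
  have hex : ∃ i s, s.length < k ∧ t ++ [i] <+: χ s := ⟨i, s, hs, hi⟩
  simp only [PathLetter.eval, dif_pos ht, pathLetter, dif_pos hex]
  obtain ⟨s', hs', h'⟩ := hex.choose_spec
  exact direction_unique hχ (by rintro s hs rfl; exact hP s hs ht) hs' hs h' hi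

theorem pathLetter_eval_snd {t : List (Fin b)} (ht : t.length = P) :
    ((pathLetter a₀ k P h χ).eval a₀ t).2 = wordLetter a₀ P h χ t := by
  simp [PathLetter.eval, pathLetter, ht]

/-- The path taken by `h` in the block, in terms of the word of the line `ℓ`. -/
theorem pathOf_eq_of_word (hχ : IsTreeMap k χ) {t s : List (Fin b)} {i : Fin b}
    (ht : t.length = P) (hP : ∀ s, s.length < k → (χ s).length ≠ P) (hs : s.length < k)
    (hi : t ++ [i] <+: χ s) : pathOf a₀ n ℓ t i =
      (List.range n).map fun σ => (((ℓ σ).getD (pathLetter a₀ k P h χ)).eval a₀ t).1 := by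
  unfold pathOf
  refine List.map_congr_left fun σ _ => ?_
  cases ℓ σ with
  | none => exact (pathLetter_eval_fst hχ ht hP hs hi).symm
  | some x => rfl

theorem elim_pathVal_of_word (hh : IsEmb a₀ k m h χ) {z : List (Fin b)} {i : Fin b}
    (hz : P ≤ z.length) (hP : ∀ s, s.length < k → (χ s).length ≠ P)
    (hzp : z.drop P <+: pathOf a₀ n ℓ (z.take P) i) :
    Sum.elim Sum.inl h (pathVal a₀ n ℓ z) = Sum.elim Sum.inl h (decode (z.take P)
      (((ℓ (z.length - P)).getD (pathLetter a₀ k P h χ)).eval a₀ (z.take P)).2) := by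
  have htl : (z.take P).length = P := by simp; omega
  unfold pathVal
  rw [if_pos ⟨i, hzp⟩]
  cases ℓ (z.length - P) with
  | some x => rfl
  | none =>
    simp only [Option.getD_none, pathLetter_eval_snd htl]
    exact (elim_decode_wordLetter hh htl fun s hs hsP => absurd hsP (hP s hs)).symm

omit [NeZero b] in
theorem prefix_blockPos_cases {z s : List (Fin b)} {stem : List (Fin b) → List (Fin b)}
    {ext : List (Fin b) → Fin b → List (Fin b)} (hz : P ≤ z.length)
    (hzs : z <+: blockPos P stem ext (χ s)) :
    P ≤ (χ s).length ∧ z.take P = (χ s).take P ∧ z.take P <+: χ s := by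
  have h1 : z.take P <+: χ s :=
    prefix_of_prefix_blockPos ((List.take_prefix _ _).trans hzs) (by simp)
  have hl : (z.take P).length = P := by simp; omega
  have h2 := h1.length_le
  refine ⟨by omega, ?_, h1⟩
  have := take_eq_of_prefix h1
  rw [hl] at this
  exact this.symm

/-- Passing from `P` to `P + n` adds only the passage through the block. The three conditions
concern the first occurrences at level `P`, the directions of the paths that continue, and the
values met on the way. -/
theorem levelEquiv_comp (hℓ : ∃ i < n, ℓ i = none) (hℓ' : ∃ i < n, ℓ' i = none)
    (H : LevelEquiv k P h χ h' χ')
    (hline : ∀ s, s.length < k → (χ s).length = P → ℓ = ℓ')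
    (hpath : ∀ s t i i', s.length < k → t.length = P → t ++ [i] <+: χ s → t ++ [i'] <+: χ' s →
      pathOf a₀ n ℓ t i = pathOf a₀ n ℓ' t i')
    (hval : ∀ z s, s.length < k → P ≤ z.length → z.length < P + n →
      z <+: blockPos P (pathStem a₀ n ℓ) (pathExt a₀ n ℓ) (χ s) →
      z <+: blockPos P (pathStem a₀ n ℓ') (pathExt a₀ n ℓ') (χ' s) →
      Sum.elim Sum.inl h (pathVal a₀ n ℓ z) = Sum.elim Sum.inl h' (pathVal a₀ n ℓ' z)) :
    LevelEquiv k (P + n)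
      (comp (blockWord a₀ P n m (pathStem a₀ n ℓ) (pathExt a₀ n ℓ) (pathVal a₀ n ℓ)) h)
      (blockPos P (pathStem a₀ n ℓ) (pathExt a₀ n ℓ) ∘ χ)
      (comp (blockWord a₀ P n m (pathStem a₀ n ℓ') (pathExt a₀ n ℓ') (pathVal a₀ n ℓ')) h')
      (blockPos P (pathStem a₀ n ℓ') (pathExt a₀ n ℓ') ∘ χ') := by
  have hstar : ∀ s, s.length < k → (χ s).length ≤ P → χ s = χ' s := by
    intro s hs hle
    have := H.take_eq s hs
    rwa [List.take_of_length_le hle, List.take_of_length_le (by rwa [← H.length_eq s hs])] at this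
  have htake : ∀ s, s.length < k →
      (blockPos P (pathStem a₀ n ℓ) (pathExt a₀ n ℓ) (χ s)).take (P + n) =
      (blockPos P (pathStem a₀ n ℓ') (pathExt a₀ n ℓ') (χ' s)).take (P + n) := by
    intro s hs
    rcases lt_trichotomy (χ s).length P with hl | hl | hl
    · rw [← hstar s hs hl.le, blockPos_of_lt hl, blockPos_of_lt hl]
    · rw [← hstar s hs hl.le, hline s hs hl]
    · obtain ⟨t, i, y, ht, hy⟩ := exists_eq_append_cons hl
      obtain ⟨t', i', y', ht', hy'⟩ := exists_eq_append_cons (H.length_eq s hs ▸ hl)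
      have htt : t = t' := by
        have := H.take_eq s hs
        rwa [hy, hy', List.take_left' ht, List.take_left' ht'] at this
      subst htt
      rw [hy, hy', blockPos_path hℓ ht, blockPos_path hℓ' ht,
        hpath s t i i' hs ht (by simp [hy]) (by simp [hy'])]
      have hl2 : (t ++ pathOf a₀ n ℓ' t i').length = P + n := by simp [ht, length_pathOf]
      rw [List.take_left' hl2, List.take_left' hl2]
  refine ⟨fun s hs => ?_, htake, fun z s hs hz hzs => ?_⟩
  · rcases lt_trichotomy (χ s).length P with hl | hl | hl
    · simp only [Function.comp]
      rw [← hstar s hs hl.le, blockPos_of_lt hl, blockPos_of_lt hl]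
    · simp only [Function.comp]
      rw [← hstar s hs hl.le, hline s hs hl]
    · have h1 := length_blockPos (length_path (a₀ := a₀) hℓ) hl
      have h2 := length_blockPos (length_path (a₀ := a₀) hℓ') (H.length_eq s hs ▸ hl)
      have := H.length_eq s hs
      simp only [Function.comp]
      omega
  · rcases Nat.lt_or_ge z.length P with hzP | hzP
    · rw [comp_of_inr (blockWord_of_lt hzP), comp_of_inr (blockWord_of_lt hzP)]
      exact H.agree z s hs hzP (prefix_of_prefix_blockPos hzs hzP.le)
    · have hzs' : z <+: blockPos P (pathStem a₀ n ℓ') (pathExt a₀ n ℓ') (χ' s) := by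
        have : z <+: (blockPos P (pathStem a₀ n ℓ) (pathExt a₀ n ℓ) (χ s)).take (P + n) :=
          List.prefix_take_iff.2 ⟨hzs, hz.le⟩
        rw [htake s hs] at this
        exact this.trans (List.take_prefix _ _)
      unfold comp
      rw [blockWord_of_mem_block hzP hz, blockWord_of_mem_block hzP hz]
      exact hval z s hs hzP hz hzs hzs'

end

end Level

/-! ### Removing the dependence on paths, level by level -/

section LevelStep

variable {b : ℕ} [NeZero b] {Λ : Type*} {a₀ : Λ} {k m P n : ℕ}
  {ℓ ℓ' : ℕ → Option (PathLetter b Λ P)} {h h' : Word b Λ} {χ χ' : List (Fin b) → List (Fin b)}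

theorem drop_prefix_pathOf (hℓ : ∃ i < n, ℓ i = none) {t y z : List (Fin b)} {i : Fin b}
    (ht : t.length = P) (hz : P ≤ z.length) (hz' : z.length < P + n)
    (hzs : z <+: blockPos P (pathStem a₀ n ℓ) (pathExt a₀ n ℓ) (t ++ i :: y)) :
    z.take P = t ∧ z.drop P <+: pathOf a₀ n ℓ t i := by
  rw [blockPos_path hℓ ht] at hzs
  have h1 : z <+: t ++ pathOf a₀ n ℓ t i := by
    refine List.prefix_of_prefix_length_le hzs (List.prefix_append _ _) ?_
    simp [ht, length_pathOf]
    omega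
  obtain ⟨w, rfl⟩ := List.prefix_of_prefix_length_le (List.prefix_append _ _) h1 (ht ▸ hz)
  rw [List.prefix_append_right_inj] at h1
  exact ⟨List.take_left' ht, by rwa [List.drop_left' ht]⟩

/-- Lines that induce the same word on the paths of `h` and `h'`. -/
theorem levelEquiv_comp_of_word (hℓ : ∃ i < n, ℓ i = none) (hℓ' : ∃ i < n, ℓ' i = none)
    (hh : IsEmb a₀ k m h χ) (hh' : IsEmb a₀ k m h' χ') (H : LevelEquiv k P h χ h' χ')
    (hP : ∀ s, s.length < k → (χ s).length ≠ P)
    (hw : ∀ σ, (ℓ σ).getD (pathLetter a₀ k P h χ) = (ℓ' σ).getD (pathLetter a₀ k P h' χ')) :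
    LevelEquiv k (P + n)
      (comp (blockWord a₀ P n m (pathStem a₀ n ℓ) (pathExt a₀ n ℓ) (pathVal a₀ n ℓ)) h)
      (blockPos P (pathStem a₀ n ℓ) (pathExt a₀ n ℓ) ∘ χ)
      (comp (blockWord a₀ P n m (pathStem a₀ n ℓ') (pathExt a₀ n ℓ') (pathVal a₀ n ℓ')) h')
      (blockPos P (pathStem a₀ n ℓ') (pathExt a₀ n ℓ') ∘ χ') := by
  have hP' : ∀ s, s.length < k → (χ' s).length ≠ P := fun s hs => by
    rw [← H.length_eq s hs]
    exact hP s hs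
  refine levelEquiv_comp hℓ hℓ' H (fun s hs h => absurd h (hP s hs)) ?_ ?_
  · intro s t i i' hs ht hi hi'
    rw [pathOf_eq_of_word (h := h) hh.treeMap ht hP hs hi,
      pathOf_eq_of_word (h := h') hh'.treeMap ht hP' hs hi']
    simp only [hw]
  · intro z s hs hz hz' hzs hzs'
    obtain ⟨h1, -, -⟩ := prefix_blockPos_cases hz hzs
    obtain ⟨t, i, y, ht, hy⟩ := exists_eq_append_cons (lt_of_le_of_ne h1 (hP s hs).symm)
    obtain ⟨t', i', y', ht', hy'⟩ := exists_eq_append_cons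
      (lt_of_le_of_ne (H.length_eq s hs ▸ h1) (hP' s hs).symm)
    rw [hy] at hzs
    rw [hy'] at hzs'
    obtain ⟨rfl, h2⟩ := drop_prefix_pathOf hℓ ht hz hz' hzs
    obtain ⟨rfl, h3⟩ := drop_prefix_pathOf hℓ' ht' hz hz' hzs'
    rw [elim_pathVal_of_word hh hz hP h2, elim_pathVal_of_word hh' hz hP' h3, hw]
    generalize (((ℓ' (z.length - P)).getD (pathLetter a₀ k P h' χ')).eval a₀ (z.take P)).2 = a
    cases hd : decode (z.take P) a with
    | inl a => rfl
    | inr u =>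
      obtain ⟨h4, h5⟩ := length_lt_of_decode hd
      exact H.agree u s hs h4 (h5.trans (by rw [hy]; exact List.prefix_append _ _))

/-- A first occurrence at level `P`. -/
theorem levelEquiv_comp_of_star (hℓ : ∃ i < n, ℓ i = none)
    (hh : IsEmb a₀ k m h χ) (hh' : IsEmb a₀ k m h' χ') (H : LevelEquiv k P h χ h' χ')
    (hinj : LevelInj k χ) (hneat : Neat a₀ k h χ) (hneat' : Neat a₀ k h' χ')
    {s₀ : List (Fin b)} (hs₀ : s₀.length < k) (hP : (χ s₀).length = P) :
    LevelEquiv k (P + n)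
      (comp (blockWord a₀ P n m (pathStem a₀ n ℓ) (pathExt a₀ n ℓ) (pathVal a₀ n ℓ)) h)
      (blockPos P (pathStem a₀ n ℓ) (pathExt a₀ n ℓ) ∘ χ)
      (comp (blockWord a₀ P n m (pathStem a₀ n ℓ) (pathExt a₀ n ℓ) (pathVal a₀ n ℓ)) h')
      (blockPos P (pathStem a₀ n ℓ) (pathExt a₀ n ℓ) ∘ χ') := by
  have hstar : χ' s₀ = χ s₀ := by
    have := H.take_eq s₀ hs₀
    rw [List.take_of_length_le hP.le, List.take_of_length_le
      (by rw [← H.length_eq s₀ hs₀, hP])] at this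
    exact this.symm
  refine levelEquiv_comp hℓ hℓ H (fun _ _ _ => rfl) ?_ ?_
  · intro s t i i' hs ht hi hi'
    suffices i = i' by rw [this]
    by_cases hts : t = χ s₀
    · have h1 := hh.treeMap.append_prefix_reflect hs₀ hs (hts ▸ hi)
      exact (eq_of_append_singleton_prefix
        (hh'.treeMap.append_prefix hs h1) (by rwa [hstar, ← hts])).symm ▸ rfl
    · have hne : ∀ χ : List (Fin b) → List (Fin b), ∀ i, t ++ [i] <+: χ s → t ≠ χ s := by
        rintro χ i hi rfl
        exact (length_lt_of_append_singleton_prefix hi).ne rfl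
      have h1 := (hneat s₀ s t hs₀ hs (ht.trans hP.symm) (prefix_of_append_singleton_prefix hi)
        hts (hne χ i hi)).1
      have h2 := (hneat' s₀ s t hs₀ hs (by rw [hstar, ht, hP])
        (prefix_of_append_singleton_prefix hi') (by rwa [hstar]) (hne χ' i' hi')).1
      rw [eq_of_append_singleton_prefix hi h1, eq_of_append_singleton_prefix hi' h2]
  · intro z s hs hz hz' hzs hzs'
    obtain ⟨h1, h2, h3⟩ := prefix_blockPos_cases hz hzs
    obtain ⟨-, -, h4⟩ := prefix_blockPos_cases hz hzs'
    have htl : (z.take P).length = P := by simp; omega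
    unfold pathVal
    split_ifs with hex
    · cases ℓ (z.length - P) with
      | some x =>
        dsimp only
        cases hd : decode (z.take P) (x.eval a₀ (z.take P)).2 with
        | inl a => rfl
        | inr u =>
          obtain ⟨h5, h6⟩ := length_lt_of_decode hd
          exact H.agree u s hs h5 (h6.trans h3)
      | none =>
        simp only [Sum.elim_inr]
        by_cases hts : z.take P = χ s₀
        · rw [hts, hh.apply_pos s₀ hs₀, ← hstar, hh'.apply_pos s₀ hs₀]
        · have hne : z.take P ≠ χ s := by
            intro he
            rw [hinj s s₀ hs hs₀ (by rw [← he, htl, hP])] at he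
            exact hts he
          have hne' : z.take P ≠ χ' s := by
            intro he
            refine hne (h3.eq_of_length ?_)
            rw [H.length_eq s hs, ← he]
          rw [(hneat s₀ s _ hs₀ hs (htl.trans hP.symm) h3 hts hne).2,
            (hneat' s₀ s _ hs₀ hs (by rw [hstar, htl, hP]) h4 (by rwa [hstar]) hne').2]
    · rfl

/-- Same induction as in the first round, with equivalence below level `P` instead of equality. When
no level is left, equivalence gives equal first occurrences and equal values at live positions, and
insensitivity to dead values finishes. -/
theorem exists_insensitive_of_levelEquiv [Finite Λ] (a₀ : Λ) (k r e : ℕ) :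
    ∀ P, ∃ n, ∀ c : Word b Λ → Fin r, DeadInsensitive a₀ k n c →
      ∃ f φ, IsEmb a₀ (P + e) n f φ ∧ LevelMono (P + e) φ ∧
        ∀ h χ h' χ', IsEmb a₀ k (P + e) h χ → IsEmb a₀ k (P + e) h' χ' →
          Neat a₀ k h χ → Neat a₀ k h' χ' → LevelInj k χ → LevelEquiv k P h χ h' χ' →
            c (comp f h) = c (comp f h') := by
  classical
  induction e with
  | zero =>
    intro P
    refine ⟨P, fun c hc => ?_⟩
    obtain ⟨f, hf, -⟩ := IsEmb.exists_of_treeMap (n := P) a₀ (b := b) (m := P) (φ := id)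
      (fun t i _ => List.prefix_rfl) (fun t ht => ht)
    refine ⟨f, id, hf, fun t t' h _ => h, fun h χ h' χ' hh hh' _ _ _ H => ?_⟩
    rw [Nat.add_zero] at hh hh'
    have hχ : ∀ s, s.length < k → χ' s = χ s := by
      intro s hs
      have := H.take_eq s hs
      rw [List.take_of_length_le (hh.length_lt hs).le,
        List.take_of_length_le (hh'.length_lt hs).le] at this
      exact this.symm
    refine hc _ _ _ (hf.comp hh) (hf.comp (hh'.congr_pos hχ)) fun z s hs hz => ?_
    unfold comp
    cases hfz : f z with
    | inl a => rfl
    | inr t =>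
      obtain ⟨h1, h2⟩ := hf.of_inr z t hfz
      exact H.agree t s hs h1 (h2.trans hz)
  | succ e ih =>
    intro P
    have hPm : P < P + (e + 1) := by omega
    generalize hm : P + (e + 1) = m at hPm
    have hfinJ : Finite {t : List (Fin b) // t.length = P} :=
      (List.finite_length_eq (Fin b) P).to_subtype
    have hfinH : Finite {h : Word b Λ // ∃ χ, IsEmb a₀ k m h χ} :=
      (finite_isEmb a₀ k m).to_subtype
    let _ : Inhabited (PathLetter b Λ P) := ⟨fun _ => (0, Sum.inl a₀)⟩
    obtain ⟨n, hn⟩ := exists_line_mono (PathLetter b Λ P)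
      ({h : Word b Λ // ∃ χ, IsEmb a₀ k m h χ} → Fin r)
    obtain ⟨N, hN⟩ := ih (P + n)
    refine ⟨N, fun c hc => ?_⟩
    obtain ⟨f₁, φ₁, hf₁, hmono₁, hins⟩ := hN c hc
    let F : (ℕ → Option (PathLetter b Λ P)) → Word b Λ := fun ℓ =>
      blockWord a₀ P n m (pathStem a₀ n ℓ) (pathExt a₀ n ℓ) (pathVal a₀ n ℓ)
    have hF : ∀ ℓ, (∃ i < n, ℓ i = none) → IsEmb a₀ m (P + n + e) (F ℓ)
        (blockPos P (pathStem a₀ n ℓ) (pathExt a₀ n ℓ)) := fun ℓ hℓ =>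
      isEmb_path a₀ hPm (by omega) hℓ
    have hstep : ∀ ℓ ℓ' h χ h' χ', (hℓ : ∃ i < n, ℓ i = none) → (hℓ' : ∃ i < n, ℓ' i = none) →
        IsEmb a₀ k m h χ → IsEmb a₀ k m h' χ' → Neat a₀ k h χ → Neat a₀ k h' χ' →
        LevelInj k χ → LevelInj k χ' →
        LevelEquiv k (P + n) (comp (F ℓ) h) (blockPos P (pathStem a₀ n ℓ) (pathExt a₀ n ℓ) ∘ χ)
          (comp (F ℓ') h') (blockPos P (pathStem a₀ n ℓ') (pathExt a₀ n ℓ') ∘ χ') →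
        c (comp f₁ (comp (F ℓ) h)) = c (comp f₁ (comp (F ℓ') h')) := by
      intro ℓ ℓ' h χ h' χ' hℓ hℓ' hh hh' hneat hneat' hinj hinj' H
      have hmono := fun (ℓ : ℕ → Option (PathLetter b Λ P)) (hℓ : ∃ i < n, ℓ i = none) =>
        levelMono_blockPos m (length_path (ℓ := ℓ) (a₀ := a₀) hℓ)
      exact hins _ _ _ _ ((hF ℓ hℓ).comp hh) ((hF ℓ' hℓ').comp hh')
        (hneat.comp (hF ℓ hℓ) (hmono ℓ hℓ) (levelUniform_path m hℓ) hh hinj)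
        (hneat'.comp (hF ℓ' hℓ') (hmono ℓ' hℓ') (levelUniform_path m hℓ') hh' hinj')
        (hinj.comp (hmono ℓ hℓ) fun s hs => hh.length_lt hs) H
    -- `R w h g`: `g` induces the word `w` on the block and comes from a neat word equivalent to `h`
    -- below level `P`, without first occurrence on that level.
    let R : (ℕ → PathLetter b Λ P) → (h : {h : Word b Λ // ∃ χ, IsEmb a₀ k m h χ}) →
        Word b Λ → Prop := fun w h g =>
      ∃ ℓ h' χ', (∃ i < n, ℓ i = none) ∧ IsEmb a₀ k m h' χ' ∧ Neat a₀ k h' χ' ∧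
        LevelInj k χ' ∧ LevelEquiv k P h.1 h.2.choose h' χ' ∧
        (∀ s, s.length < k → (χ' s).length ≠ P) ∧
        (w = fun σ => (ℓ σ).getD (pathLetter a₀ k P h' χ')) ∧ g = comp (F ℓ) h'
    have hR : ∀ w h g g', R w h g → R w h g' → c (comp f₁ g) = c (comp f₁ g') := by
      rintro w h _ _ ⟨ℓ, h₁, χ₁, hℓ, hh₁, hne₁, hinj₁, H₁, hP₁, hw₁, rfl⟩
        ⟨ℓ', h₂, χ₂, hℓ', hh₂, hne₂, hinj₂, H₂, hP₂, hw₂, rfl⟩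
      exact hstep ℓ ℓ' h₁ χ₁ h₂ χ₂ hℓ hℓ' hh₁ hh₂ hne₁ hne₂ hinj₁ hinj₂
        (levelEquiv_comp_of_word hℓ hℓ' hh₁ hh₂ (H₁.symm.trans H₂) hP₁
          fun σ => congrFun (hw₁.symm.trans hw₂) σ)
    obtain ⟨ℓ, hℓ, hC⟩ := hn fun w h =>
      if hg : ∃ g, R w h g then c (comp f₁ hg.choose) else c h.1
    refine ⟨comp f₁ (F ℓ), _, hf₁.comp (hF ℓ hℓ),
      hmono₁.comp (levelMono_blockPos m (length_path hℓ)) fun s hs => (hF ℓ hℓ).length_lt hs, ?_⟩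
    intro h χ h' χ' hh hh' hneat hneat' hinj H
    have hinj' := H.levelInj hinj
    rw [comp_assoc, comp_assoc]
    -- With a first occurrence on level `P` the block passages agree for any line; without one, both
    -- words are points of the monochromatic line.
    by_cases hstar : ∃ s, s.length < k ∧ (χ s).length = P
    · obtain ⟨s₀, hs₀, hP⟩ := hstar
      exact hstep ℓ ℓ h χ h' χ' hℓ hℓ hh hh' hneat hneat' hinj hinj'
        (levelEquiv_comp_of_star hℓ hh hh' H hinj hneat hneat' hs₀ hP)
    · push Not at hstar
      let H₀ : {h : Word b Λ // ∃ χ, IsEmb a₀ k m h χ} := ⟨h, χ, hh⟩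
      have hcol : ∀ g ψ, IsEmb a₀ k m g ψ → Neat a₀ k g ψ → LevelInj k ψ →
          LevelEquiv k P h χ g ψ → c (comp f₁ (comp (F ℓ) g)) =
          (fun w (h : {h : Word b Λ // ∃ χ, IsEmb a₀ k m h χ}) =>
            if hg : ∃ g, R w h g then c (comp f₁ hg.choose) else c h.1)
            (fun σ => (ℓ σ).getD (pathLetter a₀ k P g ψ)) H₀ := by
        intro g ψ hg hgn hgi hgH
        have hRg : R (fun σ => (ℓ σ).getD (pathLetter a₀ k P g ψ)) H₀ (comp (F ℓ) g) := by
          refine ⟨ℓ, g, ψ, hℓ, hg, hgn, hgi, (LevelEquiv.of_pos_eq h fun s hs =>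
            (hh.pos_unique H₀.2.choose_spec hs).symm).trans hgH, fun s hs => ?_, rfl, rfl⟩
          rw [← hgH.length_eq s hs]
          exact hstar s hs
        have hex : ∃ g', R (fun σ => (ℓ σ).getD (pathLetter a₀ k P g ψ)) H₀ g' := ⟨_, hRg⟩
        dsimp only
        rw [dif_pos hex]
        exact hR _ _ _ _ hRg hex.choose_spec
      rw [hcol h χ hh hneat hinj (LevelEquiv.of_pos_eq h fun _ _ => rfl),
        hcol h' χ' hh' hneat' hinj' H]
      exact congrFun (hC _ _) H₀

theorem exists_levelInsensitive [Finite Λ] (a₀ : Λ) (k r m : ℕ) :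
    ∃ n, ∀ c : Word b Λ → Fin r, DeadInsensitive a₀ k n c →
      ∃ f φ, IsEmb a₀ m n f φ ∧ LevelMono m φ ∧
        ∀ h χ h' χ', IsEmb a₀ k m h χ → IsEmb a₀ k m h' χ' → Neat a₀ k h χ → Neat a₀ k h' χ' →
          LevelInj k χ → (∀ s, s.length < k → (χ s).length = (χ' s).length) →
            c (comp f h) = c (comp f h') := by
  obtain ⟨n, hn⟩ := exists_insensitive_of_levelEquiv (b := b) a₀ k r m 0
  refine ⟨n, fun c hc => ?_⟩
  obtain ⟨f, φ, hf, hm, h⟩ := hn c hc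
  rw [Nat.zero_add] at hf hm h
  exact ⟨f, φ, hf, hm, fun g χ g' χ' hg hg' hn hn' hi hl =>
    h g χ g' χ' hg hg' hn hn' hi ⟨hl, by simp, by simp⟩⟩

end LevelStep

/-! ### The breadth-first enumeration of the tree -/

section Rank

variable {b : ℕ}

/-- The position of `t` in the enumeration of the tree by length and lexicographical order. -/
def rank (t : List (Fin b)) : ℕ := t.foldl (fun r (i : Fin b) => b * r + 1 + i) 0

/-- `s` is shorter than `t`, or has the same length and is lexicographically smaller. -/
def Before (s t : List (Fin b)) : Prop :=
  s.length < t.length ∨ s.length = t.length ∧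
    ∃ v i j, i < j ∧ v ++ [i] <+: s ∧ v ++ [j] <+: t

theorem rank_append_singleton (t : List (Fin b)) (i : Fin b) :
    rank (t ++ [i]) = b * rank t + 1 + i := by
  simp [rank]

/-- The children of `r` have the numbers `b * r + 1, …, b * r + b`, so the children of a smaller
number come first. -/
theorem foldl_rank_lt {x y : List (Fin b)} (hxy : x.length = y.length) {r r' : ℕ} (h : r < r') :
    x.foldl (fun r (i : Fin b) => b * r + 1 + i) r <
      y.foldl (fun r (i : Fin b) => b * r + 1 + i) r' := by
  induction x generalizing y r r' with
  | nil => simpa [List.length_eq_zero_iff.1 hxy.symm] using h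
  | cons i x ih =>
    cases y with
    | nil => simp at hxy
    | cons j y =>
      have h1 : b * (r + 1) ≤ b * r' := Nat.mul_le_mul_left b h
      have h2 := i.2
      rw [Nat.mul_succ] at h1
      have h3 : b * r + 1 + i < b * r' + 1 + j := by omega
      rw [List.foldl_cons, List.foldl_cons]
      exact ih (by simpa using hxy) h3

theorem rank_lt_of_before {s t : List (Fin b)} (h : Before s t) : rank s < rank t := by
  rcases h with h | ⟨h, v, i, j, hij, ⟨x, rfl⟩, ⟨y, rfl⟩⟩
  · obtain ⟨p, y, rfl, hy⟩ : ∃ p y, t = p ++ y ∧ y.length = s.length :=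
      ⟨t.take (t.length - s.length), t.drop (t.length - s.length),
        (List.take_append_drop _ _).symm, by simp; omega⟩
    rw [rank, rank, List.foldl_append]
    refine foldl_rank_lt hy.symm ?_
    rcases List.eq_nil_or_concat p with rfl | ⟨q, i, rfl⟩
    · simp at h
      omega
    · simp
  · have h1 : rank (v ++ [i]) < rank (v ++ [j]) := by
      rw [rank_append_singleton, rank_append_singleton]
      omega
    unfold rank
    rw [List.foldl_append (l := v ++ [i]), List.foldl_append (l := v ++ [j])]
    exact foldl_rank_lt (by simpa using h) h1

theorem before_trichotomy (s t : List (Fin b)) : Before s t ∨ s = t ∨ Before t s := by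
  rcases lt_trichotomy s.length t.length with h | h | h
  · exact Or.inl (Or.inl h)
  · rcases prefix_trichotomy s t with h1 | ⟨i, h1⟩ | ⟨v, i, j, hij, h1, h2⟩
    · exact Or.inr (Or.inl (h1.eq_of_length h))
    · exact absurd h (length_lt_of_append_singleton_prefix h1).ne'
    · rcases lt_or_gt_of_ne hij with h3 | h3
      · exact Or.inl (Or.inr ⟨h, v, i, j, h3, h1, h2⟩)
      · exact Or.inr (Or.inr (Or.inr ⟨h.symm, v, j, i, h3, h2, h1⟩))
  · exact Or.inr (Or.inr (Or.inl h))

theorem rank_injective : Function.Injective (rank (b := b)) := by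
  intro s t h
  rcases before_trichotomy s t with h1 | h1 | h1
  · exact absurd h (rank_lt_of_before h1).ne
  · exact h1
  · exact absurd h (rank_lt_of_before h1).ne'

theorem before_of_rank_lt {s t : List (Fin b)} (h : rank s < rank t) : Before s t := by
  rcases before_trichotomy s t with h1 | rfl | h1
  · exact h1
  · exact absurd h (lt_irrefl _)
  · exact absurd h (rank_lt_of_before h1).asymm

/-- The lengths of the sequences `φ t` increase strictly in breadth-first order. -/
def LengthMono (m : ℕ) (φ : List (Fin b) → List (Fin b)) : Prop :=
  ∀ t t', t.length < m → t'.length < m → rank t < rank t' → (φ t).length < (φ t').length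

theorem LengthMono.levelInj {m : ℕ} {φ : List (Fin b) → List (Fin b)} (h : LengthMono m φ) :
    LevelInj m φ := by
  intro s t hs ht hst
  rcases lt_trichotomy (rank s) (rank t) with h1 | h1 | h1
  · exact absurd hst (h s t hs ht h1).ne
  · exact rank_injective h1
  · exact absurd hst (h t s ht hs h1).ne'

theorem LengthMono.rank_lt {m : ℕ} {φ : List (Fin b) → List (Fin b)} (h : LengthMono m φ)
    {s t : List (Fin b)} (hs : s.length < m) (ht : t.length < m)
    (hst : (φ s).length < (φ t).length) : rank s < rank t := by
  by_contra hle
  rcases (not_lt.1 hle).lt_or_eq with h1 | h1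
  · exact absurd hst (h t s ht hs h1).asymm
  · rw [rank_injective h1] at hst
    exact absurd hst (lt_irrefl _)

theorem LengthMono.comp_left {m n : ℕ} {φ ψ : List (Fin b) → List (Fin b)}
    (hψ : LengthMono m ψ) (hφ : LevelMono n φ) (hlt : ∀ s, s.length < m → (ψ s).length < n) :
    LengthMono m (φ ∘ ψ) :=
  fun t t' ht ht' h => hφ _ _ (hψ t t' ht ht' h) (hlt t' ht')

theorem eq_of_strictMono_of_range_eq {D : Type*} [Finite D] (L : LinearOrder D) (f g : D → ℕ)
    (hf : ∀ s t, L.lt s t → f s < f t) (hg : ∀ s t, L.lt s t → g s < g t)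
    (h : Set.range f = Set.range g) : f = g :=
  (StrictMono.range_inj (fun s t hst => hf s t hst) fun s t hst => hg s t hst).1 h

/-- Two families of lengths that increase in breadth-first order and have the same image agree. -/
theorem LengthMono.length_eq {k : ℕ} {χ χ' : List (Fin b) → List (Fin b)} (h : LengthMono k χ)
    (h' : LengthMono k χ')
    (himg : (fun s => (χ s).length) '' {s | s.length < k} =
      (fun s => (χ' s).length) '' {s | s.length < k}) :
    ∀ s, s.length < k → (χ s).length = (χ' s).length := by
  have hfin : Finite {s : List (Fin b) // s.length < k} :=
    (List.finite_length_lt (Fin b) k).to_subtype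
  have h3 : (fun s : {s : List (Fin b) // s.length < k} => (χ s.1).length) =
      fun s => (χ' s.1).length := by
    refine eq_of_strictMono_of_range_eq
      (LinearOrder.lift' (fun s : {s : List (Fin b) // s.length < k} => rank s.1)
        (rank_injective.comp Subtype.val_injective)) _ _
      (fun s t (hst : rank s.1 < rank t.1) => h _ _ s.2 t.2 hst)
      (fun s t (hst : rank s.1 < rank t.1) => h' _ _ s.2 t.2 hst) ?_
    rwa [Set.image_eq_range, Set.image_eq_range] at himg
  exact fun s hs => congrFun h3 ⟨s, hs⟩

end Rank

/-! ### Trees with first occurrences at prescribed levels -/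

section Sparse

variable {b : ℕ} [NeZero b]

/-- The copy of the tree in which `t` has length `η (rank t)`, and in which all directions that
are not forced are `0`. -/
def sparsePos (η : ℕ → ℕ) (t : List (Fin b)) : List (Fin b) :=
  (t.foldl (fun p (i : Fin b) => (b * p.1 + 1 + i,
    p.2 ++ i :: List.replicate (η (b * p.1 + 1 + i) - η p.1 - 1) 0))
      (0, List.replicate (η 0) 0)).2

variable {η : ℕ → ℕ}

theorem sparsePos_nil : sparsePos η ([] : List (Fin b)) = List.replicate (η 0) 0 := rfl

theorem sparsePos_append_singleton (t : List (Fin b)) (i : Fin b) :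
    sparsePos η (t ++ [i]) = sparsePos η t ++
      i :: List.replicate (η (rank (t ++ [i])) - η (rank t) - 1) 0 := by
  have key : ∀ t : List (Fin b), (t.foldl (fun p (i : Fin b) => (b * p.1 + 1 + i,
      p.2 ++ i :: List.replicate (η (b * p.1 + 1 + i) - η p.1 - 1) 0))
        ((0, List.replicate (η 0) 0) : ℕ × List (Fin b))).1 = rank t := by
    intro t
    induction t using List.reverseRecOn with
    | nil => rfl
    | append_singleton t i ih =>
      rw [List.foldl_append, rank_append_singleton, ← ih]
      rfl
  rw [sparsePos, List.foldl_append, rank_append_singleton, ← key t]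
  rfl

theorem isTreeMap_sparsePos (m : ℕ) (η : ℕ → ℕ) : IsTreeMap (b := b) m (sparsePos η) := by
  intro t i _
  rw [sparsePos_append_singleton]
  simp

theorem length_sparsePos {m : ℕ} (hη : ∀ t t' : List (Fin b), t.length < m → t'.length < m →
    rank t < rank t' → η (rank t) < η (rank t')) :
    ∀ t : List (Fin b), t.length < m → (sparsePos η t).length = η (rank t) := by
  intro t
  induction t using List.reverseRecOn with
  | nil => simp [sparsePos_nil, rank]
  | append_singleton t i ih =>
    intro ht
    have htm : t.length < m := by
      simp at ht
      omega
    have := hη t (t ++ [i]) htm ht (rank_lt_of_before (Or.inl (by simp)))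
    rw [sparsePos_append_singleton, List.length_append, ih htm]
    simp
    omega

/-- The padding consists of `0`, so any other direction can only occur at an image point. -/
theorem sparsePos_direction (t : List (Fin b)) {v : List (Fin b)} {i : Fin b}
    (h : v ++ [i] <+: sparsePos η t) : i = 0 ∨ ∃ u, u <+: t ∧ v = sparsePos η u := by
  induction t using List.reverseRecOn with
  | nil =>
    left
    exact List.eq_of_mem_replicate (h.subset (by simp))
  | append_singleton t j ih =>
    rw [sparsePos_append_singleton] at h
    rcases Nat.lt_or_ge v.length (sparsePos η t).length with hl | hl
    · have h1 : v ++ [i] <+: sparsePos η t :=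
        List.prefix_of_prefix_length_le h (List.prefix_append _ _) (by simpa using hl)
      rcases ih h1 with h2 | ⟨u, hu, rfl⟩
      · exact Or.inl h2
      · exact Or.inr ⟨u, hu.trans (List.prefix_append _ _), rfl⟩
    · obtain ⟨w, rfl⟩ := List.prefix_of_prefix_length_le (List.prefix_append _ _)
        (prefix_of_append_singleton_prefix h) hl
      rw [List.append_assoc, List.prefix_append_right_inj] at h
      cases w with
      | nil => exact Or.inr ⟨t, List.prefix_append _ _, by simp⟩
      | cons j' w =>
        rw [List.cons_append, List.cons_prefix_cons] at h
        exact Or.inl (List.eq_of_mem_replicate (h.2.subset (by simp)))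

variable {Λ : Type*}

/-- All words obtained from a word with sparse first occurrences are neat. -/
theorem neat_comp_sparse {a₀ : Λ} {k m : ℕ} {f h : Word b Λ} {χ : List (Fin b) → List (Fin b)}
    (hη : ∀ t t' : List (Fin b), t.length < m → t'.length < m →
      rank t < rank t' → η (rank t) < η (rank t'))
    (hf' : ∀ z, (∀ t, t.length < m → z ≠ sparsePos η t) → f z = Sum.inl a₀)
    (hh : IsEmb a₀ k m h χ) : Neat a₀ k (comp f h) (sparsePos η ∘ χ) := by
  intro s s' v hs hs' hv hvs hne hne'
  -- The image points have distinct lengths, so the level of `sparsePos η (χ s)` contains no other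
  -- image point.
  have hnot : ∀ u, u.length < m → v ≠ sparsePos η u := by
    rintro u hu rfl
    simp only [Function.comp] at hv
    rw [length_sparsePos hη u hu, length_sparsePos hη _ (hh.length_lt hs)] at hv
    rcases lt_trichotomy (rank u) (rank (χ s)) with h1 | h1 | h1
    · exact absurd hv (hη _ _ hu (hh.length_lt hs) h1).ne
    · rw [rank_injective h1] at hne
      exact hne rfl
    · exact absurd hv (hη _ _ (hh.length_lt hs) hu h1).ne'
  refine ⟨?_, comp_of_inl (hf' v hnot)⟩
  obtain ⟨i, hi⟩ := exists_append_singleton_prefix hvs hne'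
  rcases sparsePos_direction _ hi with rfl | ⟨u, hu, rfl⟩
  · exact hi
  · exact absurd rfl (hnot u (hu.length_le.trans_lt (hh.length_lt hs')))

open Classical in
/-- The theorem for words indexed by the infinite tree. -/
theorem exists_monochromatic_word [Finite Λ] (a₀ : Λ) (k m r : ℕ) :
    ∃ n, ∀ c : Word b Λ → Fin (r + 1), ∃ f φ, IsEmb a₀ m n f φ ∧ LengthMono m φ ∧
      ∃ i, ∀ h χ, IsEmb a₀ k m h χ →
        (∀ s s', s.length < k → s'.length < k → rank s < rank s' → rank (χ s) < rank (χ s')) →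
          c (comp f h) = i := by
  let nodes : ℕ → Finset (List (Fin b)) := fun l => (List.finite_length_lt (Fin b) l).toFinset
  have hnodes : ∀ l t, t ∈ nodes l ↔ t.length < l := by simp [nodes]
  -- The colored sets have one element for each variable of `h`; the homogeneous set must offer one
  -- length for each rank of a node of the tree of height `m`.
  obtain ⟨N, hN⟩ := exists_homogeneous r (nodes k).card ((nodes m).sup rank + 1)
  obtain ⟨n₂, hn₂⟩ := exists_levelInsensitive (b := b) a₀ k (r + 1) N
  obtain ⟨n₁, hn₁⟩ := exists_deadInsensitive (b := b) a₀ k (r + 1) n₂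
  refine ⟨n₁, fun c => ?_⟩
  obtain ⟨f₁, φ₁, hf₁, hmono₁, hdead⟩ := hn₁ c
  obtain ⟨f₂, φ₂, hf₂, hmono₂, hlevel⟩ := hn₂ _ hdead
  -- `Q S g`: `g` is neat and its first occurrences have exactly the lengths in `S`. Breadth-first
  -- order then fixes which length belongs to which variable, so `S` determines the color.
  let Q : Finset ℕ → Word b Λ → Prop := fun S g => ∃ ψ, IsEmb a₀ k N g ψ ∧ Neat a₀ k g ψ ∧
    LengthMono k ψ ∧ S = (nodes k).image fun s => (ψ s).length
  have hQ : ∀ S g g', Q S g → Q S g' → c (comp f₁ (comp f₂ g)) = c (comp f₁ (comp f₂ g')) := by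
    rintro S g g' ⟨ψ, hg, hn, hl, rfl⟩ ⟨ψ', hg', hn', hl', hS⟩
    refine hlevel g ψ g' ψ' hg hg' hn hn' hl.levelInj (hl.length_eq hl' ?_)
    have := congrArg (fun S : Finset ℕ => (S : Set ℕ)) hS
    simpa [nodes] using this
  obtain ⟨Y, hYN, hYc, i, hi⟩ := hN (Finset.range N) (by simp) fun S =>
    if hS : ∃ g, Q S g then c (comp f₁ (comp f₂ hS.choose)) else 0
  -- The increasing enumeration of `Y`; the value `0` past its end is not used.
  let η : ℕ → ℕ := fun j =>
    if hj : j < (nodes m).sup rank + 1 then Y.orderEmbOfFin hYc ⟨j, hj⟩ else 0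
  have hlt : ∀ t : List (Fin b), t.length < m → rank t < (nodes m).sup rank + 1 := fun t ht =>
    Nat.lt_succ_of_le (Finset.le_sup (f := rank) ((hnodes m t).2 ht))
  have hη : ∀ t t' : List (Fin b), t.length < m → t'.length < m →
      rank t < rank t' → η (rank t) < η (rank t') := by
    intro t t' ht ht' h
    simp only [η, dif_pos (hlt t ht), dif_pos (hlt t' ht')]
    exact (Y.orderEmbOfFin hYc).strictMono h
  have hηY : ∀ t : List (Fin b), t.length < m → η (rank t) ∈ Y := by
    intro t ht
    simp only [η, dif_pos (hlt t ht)]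
    exact Y.orderEmbOfFin_mem hYc _
  have hlen := length_sparsePos hη
  obtain ⟨f₃, hf₃, hf₃'⟩ := IsEmb.exists_of_treeMap (n := N) a₀ (isTreeMap_sparsePos m η)
    fun t ht => by
      rw [hlen t ht]
      exact Finset.mem_range.1 (hYN (hηY t ht))
  have hmono₃ : LengthMono m (sparsePos (b := b) η) := by
    intro t t' ht ht' h
    rw [hlen t ht, hlen t' ht']
    exact hη t t' ht ht' h
  refine ⟨comp f₁ (comp f₂ f₃), _, hf₁.comp (hf₂.comp hf₃),
    (hmono₃.comp_left hmono₂ fun s hs => hf₃.length_lt hs).comp_left hmono₁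
      fun s hs => (hf₂.comp hf₃).length_lt hs, i, fun h χ hh hrank => ?_⟩
  have hχ : ∀ s, s.length < k → (χ s).length < m := fun s hs => hh.length_lt hs
  have hmono : LengthMono k (sparsePos η ∘ χ) := fun s s' hs hs' hss' =>
    hmono₃ _ _ (hχ s hs) (hχ s' hs') (hrank s s' hs hs' hss')
  have hQ' : Q ((nodes k).image fun s => ((sparsePos η ∘ χ) s).length) (comp f₃ h) :=
    ⟨_, hf₃.comp hh, neat_comp_sparse hη hf₃' hh, hmono, rfl⟩
  have hcol := hi ((nodes k).image fun s => ((sparsePos η ∘ χ) s).length) (by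
    intro x hx
    obtain ⟨s, hs, rfl⟩ := Finset.mem_image.1 hx
    have hs' := hχ s ((hnodes k s).1 hs)
    simp only [Function.comp]
    rw [hlen _ hs']
    exact hηY _ hs') (by
    refine Finset.card_image_of_injOn fun s hs s' hs' he => ?_
    exact hmono.levelInj s s' ((hnodes k s).1 hs) ((hnodes k s').1 hs') he)
  have hex : ∃ g, Q ((nodes k).image fun s => ((sparsePos η ∘ χ) s).length) g := ⟨_, hQ'⟩
  rw [dif_pos hex] at hcol
  rw [comp_assoc, comp_assoc, ← hcol]
  exact hQ _ _ _ hQ' hex.choose_spec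

end Sparse

/-! ### Complete skew subtrees as copies of the tree -/

section SkewSubtrees

variable {b m n k : ℕ} {φ : List (Fin b) → List (Fin b)}

/-- The nodes of the form `φ t` with `|t| < m`. -/
def nodeSet (n m : ℕ) (φ : List (Fin b) → List (Fin b)) : Set (Node b n) :=
  {z | ∃ t : List (Fin b), t.length < m ∧ z.1 = φ t}

instance Node.Init.instRefl : Std.Refl (Node.Init (b := b) (n := n)) :=
  ⟨fun _ => List.prefix_rfl⟩

theorem Node.SInit.length_lt {s t : Node b n} (h : Node.SInit s t) : s.1.length < t.1.length :=
  lt_of_le_of_ne h.1.length_le fun he => h.2 (Subtype.ext (h.1.eq_of_length he))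

theorem Node.sInit_of_append {s t : Node b n} {i : Fin b} (h : s.1 ++ [i] <+: t.1) :
    Node.SInit s t := by
  refine ⟨prefix_of_append_singleton_prefix h, ?_⟩
  rintro rfl
  exact absurd (length_lt_of_append_singleton_prefix h) (lt_irrefl _)

theorem Node.SInit.exists_append {s t : Node b n} (h : Node.SInit s t) :
    ∃ i, s.1 ++ [i] <+: t.1 :=
  exists_append_singleton_prefix h.1 fun he => h.2 (Subtype.ext he)

/-- A branch of a copy of the tree has as many nodes as its preimage has initial segments. -/
theorem ncard_branch (hφ : IsTreeMap m φ) (hlt : ∀ t, t.length < m → (φ t).length < n)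
    {t : List (Fin b)} {l : ℕ} (ht : t.length < m) (hl : l ≤ t.length + 1) :
    {z : Node b n | ∃ s, s <+: t ∧ s.length < l ∧ z.1 = φ s}.ncard = l := by
  have hle : ∀ i, (t.take i).length < m := fun i => (t.length_take_le' i).trans_lt ht
  refine Set.ncard_eq_of_bijective (fun i _ => ⟨φ (t.take i), hlt _ (hle i)⟩) ?_ ?_ ?_
  · rintro ⟨z, hz⟩ ⟨s, hs, hsl, hzs⟩
    refine ⟨s.length, hsl, Subtype.ext ?_⟩
    simp only [take_eq_of_prefix hs]
    exact hzs.symm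
  · intro i hi
    refine ⟨t.take i, List.take_prefix _ _, ?_, rfl⟩
    simp
    omega
  · intro i j hi hj hij
    have := congrArg List.length (hφ.injOn (hle i) (hle j) (congrArg Subtype.val hij))
    simp at this
    omega

theorem height_nodeSet (hφ : IsTreeMap m φ) (hlt : ∀ t, t.length < m → (φ t).length < n)
    {t : List (Fin b)} (ht : t.length < m) {z : Node b n} (hz : z.1 = φ t) :
    height (nodeSet n m φ) z = t.length := by
  rw [height, ← ncard_branch hφ hlt ht (Nat.le_succ t.length)]
  congr 1
  ext y
  constructor
  · rintro ⟨⟨s, hs, hy⟩, hyz⟩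
    have hst : s <+: t := hφ.prefix_reflect hs ht (by rw [← hy, ← hz]; exact hyz.1)
    refine ⟨s, hst, lt_of_le_of_ne hst.length_le fun he => hyz.2 (Subtype.ext ?_), hy⟩
    rw [hy, hz, hst.eq_of_length he]
  · rintro ⟨s, hst, hsl, hy⟩
    obtain ⟨i, hi⟩ := exists_append_singleton_prefix_of_length_lt hst hsl
    refine ⟨⟨s, hsl.trans ht, hy⟩, Node.sInit_of_append (i := i) ?_⟩
    rw [hy, hz]
    exact hφ.append_prefix ht hi

/-- Heights are lengths of preimages, since `φ` preserves and reflects initial segments; the length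
conditions then follow from breadth-first monotonicity. -/
theorem isCompleteSkew_nodeSet [NeZero b] (hm : 0 < m) (hφ : IsTreeMap m φ)
    (hlt : ∀ t, t.length < m → (φ t).length < n) (hmono : LengthMono m φ) :
    IsCompleteSkew m (nodeSet n m φ) where
  exists_min := by
    refine ⟨⟨φ [], hlt [] hm⟩, ⟨[], hm, rfl⟩, ?_⟩
    rintro z ⟨t, ht, hz⟩
    simp only [Node.Init, hz]
    exact hφ.prefix_mono ht t.nil_prefix
  maxChain_card := by
    rintro C ⟨hCT, hC, hmax⟩
    have hne : C.Nonempty := by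
      by_contra hemp
      rw [Set.not_nonempty_iff_eq_empty] at hemp
      have := hmax {⟨φ [], hlt [] hm⟩} (by rintro _ rfl; exact ⟨[], hm, rfl⟩)
        Set.subsingleton_singleton.isChain (by simp [hemp])
      exact Set.singleton_ne_empty _ (this.trans hemp)
    have hfin : Finite (Node b n) := (List.finite_length_lt (Fin b) n).to_subtype
    obtain ⟨z, hzC, hz⟩ := C.toFinite.exists_maximalFor (fun z : Node b n => z.1.length) C hne
    obtain ⟨t, ht, hzt⟩ := hCT hzC
    -- The preimage of the top of the chain is continued to full length; the branch of `t'` contains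
    -- `C`, so by maximality it is `C`.
    let t' := t ++ List.replicate (m - 1 - t.length) 0
    have ht' : t'.length + 1 = m := by
      simp [t']
      omega
    have hD := hmax {z : Node b n | ∃ s, s <+: t' ∧ s.length < m ∧ z.1 = φ s}
      (by rintro y ⟨s, -, hs, hy⟩; exact ⟨s, hs, hy⟩) (by
        rintro y ⟨s, hs, hsm, hy⟩ y' ⟨s', hs', hsm', hy'⟩ -
        simp only [Node.Init, hy, hy']
        rcases List.prefix_or_prefix_of_prefix hs hs' with h | h
        · exact Or.inl (hφ.prefix_mono hsm' h)
        · exact Or.inr (hφ.prefix_mono hsm h)) (by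
        intro y hy
        obtain ⟨s, hs, hys⟩ := hCT hy
        have hyz : y.1 <+: z.1 := by
          rcases hC.total hy hzC with h | h
          · exact h
          · have h1 := hz hy h.length_le
            rw [h.eq_of_length (le_antisymm h.length_le h1)]
        rw [hys, hzt] at hyz
        exact ⟨s, (hφ.prefix_reflect hs ht hyz).trans (List.prefix_append _ _), hs, hys⟩)
    rw [← hD]
    exact ncard_branch hφ hlt (by omega) ht'.ge
  len_le_of_lex := by
    rintro z ⟨t, ht, hz⟩ z' ⟨t', ht', hz'⟩ hh hlex
    rw [height_nodeSet hφ hlt ht hz, height_nodeSet hφ hlt ht' hz'] at hh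
    simp only [Node.len, Node.LexLE, Node.Init, hz, hz'] at hlex ⊢
    by_contra hlen
    -- If `z` were longer, `t'` would precede `t`. The splitting point `u` of the images is `φ v`
    -- for the splitting point `v` of `t` and `t'`, with the directions in the opposite order.
    have hb := before_of_rank_lt (hmono.rank_lt ht' ht (not_le.1 hlen))
    rcases hlex with h | ⟨u, i, j, hij, h1, h2⟩
    · exact hlen h.length_le
    · rcases hb with hb | ⟨-, v, i', j', hij', h1', h2'⟩
      · omega
      · have h1'' := hφ.append_prefix ht' h1'
        have h2'' := hφ.append_prefix ht h2'
        rcases lt_trichotomy u.length (φ v).length with h | h | h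
        · obtain ⟨l, hl⟩ := exists_append_singleton_prefix_of_length_lt
            (List.prefix_of_prefix_length_le (prefix_of_append_singleton_prefix h1)
              (prefix_of_append_singleton_prefix h2'') h.le) h
          have e1 := eq_of_append_singleton_prefix h1
            (hl.trans (prefix_of_append_singleton_prefix h2''))
          have e2 := eq_of_append_singleton_prefix h2
            (hl.trans (prefix_of_append_singleton_prefix h1''))
          exact absurd hij (by rw [e1, e2]; exact lt_irrefl _)
        · have hu := (List.prefix_of_prefix_length_le (prefix_of_append_singleton_prefix h1)
              (prefix_of_append_singleton_prefix h2'') h.le).eq_of_length h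
          rw [hu] at h1 h2
          rw [eq_of_append_singleton_prefix h1 h2'', eq_of_append_singleton_prefix h2 h1''] at hij
          exact hij.asymm hij'
        · obtain ⟨l, hl⟩ := exists_append_singleton_prefix_of_length_lt
            (List.prefix_of_prefix_length_le (prefix_of_append_singleton_prefix h2'')
              (prefix_of_append_singleton_prefix h1) h.le) h
          have e1 := eq_of_append_singleton_prefix h2''
            (hl.trans (prefix_of_append_singleton_prefix h1))
          have e2 := eq_of_append_singleton_prefix h1''
            (hl.trans (prefix_of_append_singleton_prefix h2))
          exact absurd hij' (by rw [e1, e2]; exact lt_irrefl _)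
  len_lt_of_height := by
    rintro z ⟨t, ht, hz⟩ z' ⟨t', ht', hz'⟩ hh
    rw [height_nodeSet hφ hlt ht hz, height_nodeSet hφ hlt ht' hz'] at hh
    simp only [Node.len, hz, hz']
    exact hmono t t' ht ht' (rank_lt_of_before (Or.inl hh))
  existsUnique_succ := by
    rintro z ⟨t, ht, hz⟩ ⟨z', ⟨t', ht', hz'⟩, hzz'⟩ i
    have htm : (t ++ [i]).length < m := by
      obtain ⟨j, hj⟩ := hzz'.exists_append
      rw [hz, hz'] at hj
      have := length_lt_of_append_singleton_prefix (hφ.append_prefix_reflect ht ht' hj)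
      simp
      omega
    have hti := hφ.append_prefix htm List.prefix_rfl
    refine ⟨⟨φ (t ++ [i]), hlt _ htm⟩, ⟨⟨⟨_, htm, rfl⟩, Node.sInit_of_append (i := i) (by rwa [hz]),
      ?_⟩, by rwa [hz]⟩, ?_⟩
    · rintro ⟨y, ⟨s, hs, hy⟩, h1, h2⟩
      obtain ⟨j, hj⟩ := h1.exists_append
      obtain ⟨j', hj'⟩ := h2.exists_append
      rw [hz, hy] at hj
      rw [hy] at hj'
      have e1 := length_lt_of_append_singleton_prefix (hφ.append_prefix_reflect ht hs hj)
      have e2 := length_lt_of_append_singleton_prefix (hφ.append_prefix_reflect hs htm hj')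
      simp at e2
      omega
    · rintro y ⟨⟨⟨s, hs, hy⟩, -, hno⟩, hzy⟩
      rw [hz, hy] at hzy
      have hts := hφ.append_prefix_reflect ht hs hzy
      refine Subtype.ext ?_
      simp only [hy]
      by_contra hne
      obtain ⟨j, hj⟩ := exists_append_singleton_prefix hts fun he => hne (by rw [he])
      refine hno ⟨⟨φ (t ++ [i]), hlt _ htm⟩, ⟨_, htm, rfl⟩,
        Node.sInit_of_append (i := i) (by rwa [hz]), Node.sInit_of_append (i := j) ?_⟩
      rw [hy]
      exact hφ.append_prefix hs hj

variable {S : Set (Node b n)}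

theorem height_lt_height {s t : Node b n} (hs : s ∈ S) (hst : Node.SInit s t) :
    height S s < height S t := by
  have hfin : Finite (Node b n) := (List.finite_length_lt (Fin b) n).to_subtype
  refine Set.ncard_lt_ncard ⟨fun y hy => ⟨hy.1, hy.2.1.trans hst.1, ?_⟩, fun h => ?_⟩
    (Set.toFinite _)
  · rintro rfl
    exact absurd hst.length_lt hy.2.length_lt.asymm
  · exact (h (show s ∈ predSet S t from ⟨hs, hst⟩)).2.2 rfl

/-- A maximal node together with its predecessors is a maximal chain. -/
theorem IsCompleteSkew.height_add_one (hS : IsCompleteSkew k S) {z : Node b n} (hz : z ∈ S)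
    (hmax : ∀ t ∈ S, ¬ Node.SInit z t) : height S z + 1 = k := by
  have hfin : Finite (Node b n) := (List.finite_length_lt (Fin b) n).to_subtype
  have hnot : z ∉ predSet S z := fun h => h.2.2 rfl
  rw [height, ← Set.ncard_insert_of_notMem hnot (Set.toFinite _)]
  have hpre : ∀ y, y ∈ insert z (predSet S z) → y.1 <+: z.1 := by
    rintro y (rfl | hy)
    · exact List.prefix_rfl
    · exact hy.2.1
  refine hS.maxChain_card _ ⟨?_, fun y hy y' hy' _ =>
    List.prefix_or_prefix_of_prefix (hpre y hy) (hpre y' hy'), fun D hDS hD hle => ?_⟩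
  · rintro y (rfl | hy)
    · exact hz
    · exact hy.1
  · refine Set.Subset.antisymm (fun y hy => ?_) hle
    by_cases hyz : y = z
    · exact Or.inl hyz
    · rcases hD.total hy (hle (Set.mem_insert _ _)) with h | h
      · exact Or.inr ⟨hDS hy, h, hyz⟩
      · exact absurd ⟨h, Ne.symm hyz⟩ (hmax y (hDS hy))

theorem IsCompleteSkew.height_lt (hS : IsCompleteSkew k S) {z : Node b n} (hz : z ∈ S) :
    height S z < k := by
  have hfin : Finite (Node b n) := (List.finite_length_lt (Fin b) n).to_subtype
  obtain ⟨t, ⟨htS, hzt⟩, ht⟩ := Set.Finite.exists_maximalFor (fun z : Node b n => z.1.length)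
    {t ∈ S | Node.Init z t} (Set.toFinite _) ⟨z, hz, List.prefix_rfl⟩
  have h1 := hS.height_add_one htS fun y hy hty =>
    absurd (ht ⟨hy, hzt.trans hty.1⟩ hty.length_lt.le) (not_le.2 hty.length_lt)
  by_cases he : z = t
  · rw [he]
    omega
  · have := height_lt_height hz (t := t) ⟨hzt, he⟩
    omega

theorem height_of_mem_imSucc {s t : Node b n} (hs : s ∈ S) (ht : t ∈ imSucc S s) :
    height S t = height S s + 1 := by
  have hfin : Finite (Node b n) := (List.finite_length_lt (Fin b) n).to_subtype
  have hnot : s ∉ predSet S s := fun h => h.2.2 rfl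
  rw [height, height, ← Set.ncard_insert_of_notMem hnot (Set.toFinite _)]
  congr 1
  ext y
  constructor
  · rintro ⟨hy, hyt⟩
    by_cases hys : y = s
    · exact Or.inl hys
    · rcases List.prefix_or_prefix_of_prefix hyt.1 ht.2.1.1 with h | h
      · exact Or.inr ⟨hy, h, hys⟩
      · exact absurd ⟨y, hy, ⟨h, Ne.symm hys⟩, hyt⟩ ht.2.2
  · rintro (rfl | hy)
    · exact ⟨hs, ht.2.1⟩
    · refine ⟨hy.1, hy.2.1.trans ht.2.1.1, ?_⟩
      rintro rfl
      exact absurd hy.2.length_lt ht.2.1.length_lt.asymm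

/-- Every complete skew subtree is a copy of the tree. -/
theorem IsCompleteSkew.exists_treeMap (hS : IsCompleteSkew k S) :
    ∃ ψ : List (Fin b) → Node b n, IsTreeMap k (fun s => (ψ s).1) ∧
      (∀ s, s.length < k → ψ s ∈ S ∧ height S (ψ s) = s.length) ∧
        ∀ z ∈ S, ∃ s : List (Fin b), s.length < k ∧ ψ s = z := by
  classical
  have hfin : Finite (Node b n) := (List.finite_length_lt (Fin b) n).to_subtype
  obtain ⟨r, hr, hmin⟩ := hS.exists_min
  have hsucc : ∀ z ∈ S, height S z + 1 < k → ∀ i, ∃! t, t ∈ imSucc S z ∧ z.1 ++ [i] <+: t.1 := by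
    intro z hz hzk
    refine hS.existsUnique_succ z hz ?_
    by_contra hno
    have := hS.height_add_one hz fun t ht hzt => hno ⟨t, ht, hzt⟩
    omega
  let next : Node b n → Fin b → Node b n := fun z i =>
    if h : ∃ t, t ∈ imSucc S z ∧ z.1 ++ [i] <+: t.1 then h.choose else z
  have hnext : ∀ z ∈ S, height S z + 1 < k → ∀ i,
      next z i ∈ imSucc S z ∧ z.1 ++ [i] <+: (next z i).1 := by
    intro z hz hzk i
    have h := (hsucc z hz hzk i).exists
    simp only [next, dif_pos h]
    exact h.choose_spec
  let ψ : List (Fin b) → Node b n := fun s => s.foldl next r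
  have hψ : ∀ s i, ψ (s ++ [i]) = next (ψ s) i := by simp [ψ]
  have hr0 : height S r = 0 := by
    rw [height, Set.ncard_eq_zero (Set.toFinite _), Set.eq_empty_iff_forall_notMem]
    rintro y ⟨hy, hyr⟩
    exact hyr.2 (Subtype.ext (prefix_antisymm hyr.1 (hmin y hy)))
  have hmem : ∀ s : List (Fin b), s.length < k → ψ s ∈ S ∧ height S (ψ s) = s.length := by
    intro s
    induction s using List.reverseRecOn with
    | nil => exact fun _ => ⟨hr, hr0⟩
    | append_singleton s i ih =>
      intro hs
      simp only [List.length_append, List.length_singleton] at hs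
      obtain ⟨h1, h2⟩ := ih (by omega)
      have h3 := (hnext _ h1 (by omega) i).1
      rw [hψ, height_of_mem_imSucc h1 h3, h2]
      exact ⟨h3.1, by simp⟩
  refine ⟨ψ, fun s i hs => ?_, hmem, fun z hz => ?_⟩
  · obtain ⟨h1, h2⟩ := hmem s (by omega)
    simp only [hψ]
    exact (hnext _ h1 (by omega) i).2
  · induction hl : z.1.length using Nat.strong_induction_on generalizing z with
    | _ l ih =>
      by_cases hzr : z = r
      · exact ⟨[], (Nat.zero_le _).trans_lt (hS.height_lt hr), hzr.symm⟩
      -- The longest predecessor of `z` has `z` as an immediate successor, so `z` is reached from it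
      -- in one step.
      · obtain ⟨p, hp, hpmax⟩ := Set.Finite.exists_maximalFor (fun z : Node b n => z.1.length)
          (predSet S z) (Set.toFinite _) ⟨r, hr, hmin z hz, Ne.symm hzr⟩
        obtain ⟨s, hs, rfl⟩ := ih _ (hl ▸ hp.2.length_lt) p hp.1 rfl
        have hzs : z ∈ imSucc S (ψ s) := ⟨hz, hp.2, fun ⟨y, hy, h1, h2⟩ =>
          absurd (hpmax ⟨hy, h2⟩ h1.length_lt.le) (not_le.2 h1.length_lt)⟩
        obtain ⟨i, hi⟩ := hp.2.exists_append
        have hk : height S (ψ s) + 1 < k := by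
          rw [← height_of_mem_imSucc hp.1 hzs]
          exact hS.height_lt hz
        refine ⟨s ++ [i], ?_, ?_⟩
        · rw [(hmem s hs).2] at hk
          simpa using hk
        · rw [hψ]
          exact (hsucc _ hp.1 hk i).unique (hnext _ hp.1 hk i) ⟨hzs, hi⟩

end SkewSubtrees

/-! ### Variable words on the finite tree -/

section Substitution

variable {b n : ℕ} {Λ : Type*}

theorem eq_of_forall_elim_eq [Nontrivial Λ] {ι : Type*} {p q : Λ ⊕ ι}
    (h : ∀ α : ι → Λ, Sum.elim id α p = Sum.elim id α q) : p = q := by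
  classical
  have key : ∀ (a : Λ) (s : ι), ¬ ∀ α : ι → Λ, a = α s := by
    intro a s h
    obtain ⟨a', ha'⟩ := exists_ne a
    exact ha' (h fun _ => a').symm
  rcases p with a | s <;> rcases q with a' | s'
  · exact congrArg Sum.inl (h fun _ => a)
  · exact absurd h (key a s')
  · exact absurd (fun α => (h α).symm) (key a' s)
  · obtain ⟨a, a', ha⟩ := exists_pair_ne Λ
    by_contra hne
    have hs : s' ≠ s := fun he => hne (by rw [he])
    have := h fun x => if x = s then a else a'
    simp [hs] at this
    exact ha this

variable [Nontrivial Λ] {f g : Node b n → Λ ⊕ Node b n}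

theorem eq_inl_of_span_subset (h : span g ⊆ span f) {x : Node b n} {a : Λ}
    (hx : f x = Sum.inl a) : g x = Sum.inl a := by
  refine eq_of_forall_elim_eq fun α => ?_
  obtain ⟨β, hβ⟩ := h ⟨α, rfl⟩
  have := congrFun hβ x
  simpa [substitute, hx] using this

/-- Together with `eq_inl_of_span_subset` this makes `g` factor through `f`. -/
theorem eq_of_span_subset (h : span g ⊆ span f) {x y : Node b n} (hxy : f x = f y) :
    g x = g y := by
  refine eq_of_forall_elim_eq fun α => ?_
  obtain ⟨β, hβ⟩ := h ⟨α, rfl⟩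
  have hx := congrFun hβ x
  have hy := congrFun hβ y
  simp only [substitute, hxy] at hx hy
  rw [hx, hy]

end Substitution

/-! ### Passing between words on the infinite tree and words on `b^{<n}` -/

section Restriction

variable {b k m n : ℕ} {Λ Λ' : Type*} {a₀ : Λ'} {f g : Word b Λ'}
  {φ ψ : List (Fin b) → List (Fin b)}

/-- The word on `b^{<n}` obtained from `g`, where the variable `v_t` becomes the variable indexed
by `φ t` and the alphabets are identified by `e`. -/
def restrict (n : ℕ) (e : Λ ≃ Λ') (φ : List (Fin b) → List (Fin b)) (g : Word b Λ') :
    Node b n → Λ ⊕ Node b n := fun z =>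
  Sum.map e.symm (fun t => if h : (φ t).length < n then ⟨φ t, h⟩ else z) (g z.1)

theorem restrict_of_inl (e : Λ ≃ Λ') {z : Node b n} {a : Λ'} (hz : g z.1 = Sum.inl a) :
    restrict n e φ g z = Sum.inl (e.symm a) := by
  simp [restrict, hz]

theorem restrict_of_inr (e : Λ ≃ Λ') {z : Node b n} {t : List (Fin b)} (hz : g z.1 = Sum.inr t)
    (h : (φ t).length < n) : restrict n e φ g z = Sum.inr ⟨φ t, h⟩ := by
  simp [restrict, hz, h]

theorem IsEmb.restrict_congr (e : Λ ≃ Λ') (hg : IsEmb a₀ k n g φ) (hg' : IsEmb a₀ k n g ψ) :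
    restrict n e φ g = restrict n e ψ g := by
  funext z
  cases hz : g z.1 with
  | inl a => rw [restrict_of_inl e hz, restrict_of_inl e hz]
  | inr t =>
    have ht := (hg.of_inr _ _ hz).1
    rw [restrict_of_inr e hz (hg.length_lt ht), restrict_of_inr e hz (hg'.length_lt ht)]
    exact congrArg Sum.inr (Subtype.ext (hg.pos_unique hg' ht))

theorem IsEmb.restrict_mem [NeZero b] (e : Λ ≃ Λ') (hm : 0 < m) (hf : IsEmb a₀ m n f φ)
    (hmono : LengthMono m φ) : restrict n e φ f ∈ variableWords b n m Λ := by
  refine ⟨nodeSet n m φ, isCompleteSkew_nodeSet hm hf.treeMap (fun t => hf.length_lt) hmono,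
    fun z y hz => ?_, ?_⟩
  · cases hfz : f z.1 with
    | inl a => simp [restrict_of_inl e hfz] at hz
    | inr t =>
      have ht := (hf.of_inr _ _ hfz).1
      rw [restrict_of_inr e hfz (hf.length_lt ht)] at hz
      exact ⟨t, ht, congrArg Subtype.val (Sum.inr_injective hz).symm⟩
  · rintro ⟨y, hy⟩ ⟨t, ht, rfl : y = φ t⟩
    refine ⟨restrict_of_inr e (hf.apply_pos t ht) hy, fun z hz => ?_⟩
    cases hfz : f z.1 with
    | inl a => simp [restrict_of_inl e hfz] at hz
    | inr s =>
      have hs := hf.of_inr _ _ hfz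
      rw [restrict_of_inr e hfz (hf.length_lt hs.1)] at hz
      rw [← Sum.inr_injective hz]
      exact hs.2

/-- Every variable word in the span of a word obtained by restriction is itself obtained by
restriction. -/
theorem IsEmb.exists_restrict_comp_eq [Nontrivial Λ] (e : Λ ≃ Λ') (hf : IsEmb a₀ m n f φ)
    (hmono : LengthMono m φ) {g : Node b n → Λ ⊕ Node b n}
    (hg : g ∈ subWords k (restrict n e φ f)) :
    ∃ h χ, IsEmb a₀ k m h χ ∧
      (∀ s s', s.length < k → s'.length < k → rank s < rank s' → rank (χ s) < rank (χ s')) ∧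
        restrict n e (φ ∘ χ) (TreeWords.comp f h) = g := by
  classical
  obtain ⟨⟨S, hS, hgS, hSg⟩, hspan⟩ := hg
  obtain ⟨ψ, hψ, hψS, honto⟩ := hS.exists_treeMap
  -- If `f` has `v_u` at `z`, then `g` takes the same value at `φ u` as at `z`, namely `v_z`. So `z`
  -- lies below `φ u`, which in turn lies below `z`.
  have hpos : ∀ z ∈ S, ∃ u, u.length < m ∧ z.1 = φ u := by
    intro z hz
    cases hfz : f z.1 with
    | inl a =>
      have := eq_inl_of_span_subset hspan (restrict_of_inl (φ := φ) e hfz)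
      rw [(hSg z hz).1] at this
      simp at this
    | inr u =>
      obtain ⟨hu, huz⟩ := hf.of_inr _ _ hfz
      have h1 : restrict n e φ f ⟨φ u, hf.length_lt hu⟩ = restrict n e φ f z := by
        rw [restrict_of_inr e hfz (hf.length_lt hu),
          restrict_of_inr e (hf.apply_pos u hu) (hf.length_lt hu)]
      have h2 := (hSg z hz).2 _ ((eq_of_span_subset hspan h1).trans (hSg z hz).1)
      exact ⟨u, hu, prefix_antisymm h2 huz⟩
  have hχ : ∀ s : List (Fin b), ∃ u, s.length < k → u.length < m ∧ (ψ s).1 = φ u := by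
    intro s
    by_cases hs : s.length < k
    · obtain ⟨u, hu⟩ := hpos _ (hψS s hs).1
      exact ⟨u, fun _ => hu⟩
    · exact ⟨[], fun h => absurd h hs⟩
  choose χ hχ using hχ
  have hinv : ∀ z : Node b n, ∃ s : List (Fin b), z ∈ S → s.length < k ∧ ψ s = z := by
    intro z
    by_cases hz : z ∈ S
    · obtain ⟨s, hs⟩ := honto z hz
      exact ⟨s, fun _ => hs⟩
    · exact ⟨[], fun h => absurd h hz⟩
  choose inv hinv using hinv
  have hinvψ : ∀ s : List (Fin b), s.length < k → inv (ψ s) = s := by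
    intro s hs
    obtain ⟨h1, h2⟩ := hinv _ (hψS s hs).1
    exact hψ.injOn h1 hs (congrArg Subtype.val h2)
  -- The value of `h` at `u` is what `g` substitutes for `v_u`, read off at the first occurrence `φ
  -- u`.
  let h : Word b Λ' := fun u =>
    if hu : u.length < m then Sum.map e inv (g ⟨φ u, hf.length_lt hu⟩) else Sum.inl a₀
  have hh : ∀ u (hu : u.length < m), h u = Sum.map e inv (g ⟨φ u, hf.length_lt hu⟩) :=
    fun u hu => dif_pos hu
  have hemb : IsEmb a₀ k m h χ := by
    refine ⟨fun s hs => ?_, fun u s hus => ?_, fun s i hs => ?_, fun u hu => dif_neg (not_lt.2 hu)⟩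
    · obtain ⟨h1, h2⟩ := hχ s hs
      have h3 : (⟨φ (χ s), hf.length_lt h1⟩ : Node b n) = ψ s := Subtype.ext h2.symm
      rw [hh _ h1, h3, (hSg _ (hψS s hs).1).1, Sum.map_inr, hinvψ s hs]
    · by_cases hu : u.length < m
      · rw [hh u hu] at hus
        cases hgu : g ⟨φ u, hf.length_lt hu⟩ with
        | inl a => simp [hgu] at hus
        | inr z =>
          have hz := hgS _ _ hgu
          simp only [hgu, Sum.map_inr, Sum.inr.injEq] at hus
          obtain ⟨h1, h2⟩ := hinv z hz
          rw [hus] at h1 h2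
          refine ⟨h1, hf.treeMap.prefix_reflect (hχ s h1).1 hu ?_⟩
          rw [← (hχ s h1).2, h2]
          exact (hSg z hz).2 _ hgu
      · simp [h, hu] at hus
    · have hs' : s.length < k := by omega
      have hsi : (s ++ [i]).length < k := by simpa using hs
      refine hf.treeMap.append_prefix_reflect (hχ s hs').1 (hχ _ hsi).1 ?_
      rw [← (hχ s hs').2, ← (hχ _ hsi).2]
      exact hψ s i hs
  refine ⟨h, χ, hemb, fun s s' hs hs' hss' => ?_, ?_⟩
  -- The skew conditions give only a weak inequality; it becomes strict because distinct nodes `φ u`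
  -- have distinct lengths.
  · have hle : (ψ s).1.length ≤ (ψ s').1.length := by
      obtain ⟨h1, h2⟩ := hψS s hs
      obtain ⟨h1', h2'⟩ := hψS s' hs'
      rcases before_of_rank_lt hss' with hl | ⟨hl, v, i, j, hij, hi, hj⟩
      · exact (hS.len_lt_of_height _ h1 _ h1' (by rwa [h2, h2'])).le
      · exact hS.len_le_of_lex _ h1 _ h1' (by rwa [h2, h2'])
          (Or.inr ⟨(ψ v).1, i, j, hij, hψ.append_prefix hs hi, hψ.append_prefix hs' hj⟩)
    rw [(hχ s hs).2, (hχ s' hs').2] at hle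
    rcases lt_trichotomy (rank (χ s)) (rank (χ s')) with h1 | h1 | h1
    · exact h1
    · rw [hemb.treeMap.injOn hs hs' (rank_injective h1)] at hss'
      exact absurd hss' (lt_irrefl _)
    · exact absurd (hmono _ _ (hχ s' hs').1 (hχ s hs).1 h1) (not_lt.2 hle)
  · funext z
    cases hfz : f z.1 with
    | inl a =>
      rw [restrict_of_inl e (comp_of_inl hfz),
        eq_inl_of_span_subset hspan (restrict_of_inl (φ := φ) e hfz)]
    | inr u =>
      have hu := (hf.of_inr _ _ hfz).1
      have hgz : g ⟨φ u, hf.length_lt hu⟩ = g z := by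
        refine eq_of_span_subset hspan ?_
        rw [restrict_of_inr e hfz (hf.length_lt hu),
          restrict_of_inr e (hf.apply_pos u hu) (hf.length_lt hu)]
      have hhu := hh u hu
      rw [hgz] at hhu
      have hcomp := (comp_of_inr (h := h) hfz).trans hhu
      cases hg : g z with
      | inl a =>
        rw [hg] at hcomp
        rw [restrict_of_inl e hcomp, e.symm_apply_apply]
      | inr y =>
        rw [hg] at hcomp
        obtain ⟨h1, h2⟩ := hinv y (hgS _ _ hg)
        have h3 := hχ (inv y) h1
        have h4 : (φ ∘ χ) (inv y) = y.1 := by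
          rw [Function.comp, ← h3.2, h2]
        rw [restrict_of_inr (φ := φ ∘ χ) e hcomp (by rw [h4]; exact y.2)]
        exact congrArg Sum.inr (Subtype.ext h4)

end Restriction

end TreeWords

theorem theorem3 (b ℓ k m r : ℕ) (hb : 0 < b) (hℓ : 2 ≤ ℓ) (hk : 0 < k) (hm : 0 < m)
    (hr : 0 < r) :
    ∃ n₀ : ℕ, 0 < n₀ ∧ ∀ n : ℕ, n₀ ≤ n → ∀ (Λ : Type*) [Fintype Λ], Fintype.card Λ = ℓ →
      ∀ c : TreeWords.variableWords b n k Λ → Fin r,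
        ∃ f ∈ TreeWords.variableWords b n m Λ, ∃ i : Fin r,
          ∀ g : TreeWords.variableWords b n k Λ, g.1 ∈ TreeWords.subWords k f → c g = i := by
  classical
  have : NeZero b := ⟨hb.ne'⟩
  obtain ⟨r, rfl⟩ := Nat.exists_eq_succ_of_ne_zero hr.ne'
  let a₀ : Fin ℓ := ⟨0, by omega⟩
  obtain ⟨n₁, hn₁⟩ := TreeWords.exists_monochromatic_word (b := b) a₀ k m r
  refine ⟨n₁ + 1, Nat.succ_pos _, fun n hn Λ _ hΛ c => ?_⟩
  have hnt : Nontrivial Λ := Fintype.one_lt_card_iff_nontrivial.1 (by omega)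
  -- The bound is chosen before the alphabet, so the argument runs over `Fin ℓ`.
  let e : Λ ≃ Fin ℓ := Fintype.equivFinOfCardEq hΛ
  -- A word gets the color of its restriction to `b^{<n}`, which by `restrict_congr` does not depend
  -- on the chosen `φ`; all other words get the color `0`.
  obtain ⟨f, φ, hf, hmono, i, hi⟩ := hn₁ fun g =>
    if h : ∃ φ, TreeWords.IsEmb a₀ k n g φ ∧
        TreeWords.restrict n e φ g ∈ TreeWords.variableWords b n k Λ then
      c ⟨TreeWords.restrict n e h.choose g, h.choose_spec.2⟩ else 0
  have hfn := hf.mono_right (by omega : n₁ ≤ n)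
  refine ⟨_, hfn.restrict_mem e hm hmono, i, fun g hg => ?_⟩
  obtain ⟨h, χ, hh, hrank, hgh⟩ := hfn.exists_restrict_comp_eq e hmono hg
  have hex : ∃ φ, TreeWords.IsEmb a₀ k n (TreeWords.comp f h) φ ∧
      TreeWords.restrict n e φ (TreeWords.comp f h) ∈ TreeWords.variableWords b n k Λ :=
    ⟨φ ∘ χ, hfn.comp hh, hgh ▸ g.2⟩
  rw [← hi h χ hh hrank, dif_pos hex]
  congr 1
  refine Subtype.ext ?_
  rw [← hgh]
  exact (hfn.comp hh).restrict_congr e hex.choose_spec.1
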